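/- \textbf{Lemma (Hartree-type nonlinearities).} Let $2\le p\le\infty$ with $p>d/4$, let $W\in L^{\infty}(\mathbb{R}^d)+L^{p}(\mathbb{R}^d)$ (complex valued), let $s>d/2$, and set $H_1=H^s(\mathbb{R}^d)$, $H_0=L^2(\mathbb{R}^d)$ (complex-valued functions). Then: (i) The convolutions $W*|u|^2$ and $W*\operatorname{Re}(u^*v)$ exist at every point of $\mathbb{R}^d$ for all $u\in H_1$, $v\in H_0$, and $B(u)=(W*|u|^2)\,u$ is a well-defined map $B:H_1\to H_1$. (ii) For every $u\in H_1$, $B'(u)v=(W*|u|^2)\,v+2\,\bigl(W*\operatorname{Re}(u^*v)\bigr)\,u$ defines a bounded real-linear operator on $H_0$, so that $B'$ is a well-defined map from $H_1$ to the space $\mathcal{B}(H_0)$ of bounded real-linear operators on $H_0$. (iii) For all $R,\varepsilon>0$ there exist $C,\delta>0$ such that, for all $u,w\in H_1$ with $\|u\|_{H_1}\le R$ and $\|w\|_{H_1}<\delta$, $$\|B'(u)\|_{\mathcal{B}(H_0)}\le C,\qquad \|B(u+w)-B(u)-B'(u)w\|_{H_0}\le\varepsilon\,\|w\|_{H_0}.$$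 -/

import Mathlib

open MeasureTheory TemperedDistribution
open scoped ENNReal SchwartzMap Convolution ComplexConjugate

noncomputable section

/-- Euclidean space `ℝ^d`. -/
abbrev Eucl (d : ℕ) : Type := EuclideanSpace ℝ (Fin d)

/-- The space `L²(ℝ^d)` of complex-valued functions. -/
abbrev L2 (d : ℕ) : Type := Lp ℂ 2 (volume : Measure (Eucl d))

/-- `L²` functions are determined by the tempered distribution they induce. -/
theorem L2.toTemperedDistribution_injective {d : ℕ} {f g : L2 d}
    (h : (f : 𝓢'(Eucl d, ℂ)) = (g : 𝓢'(Eucl d, ℂ))) : f = g := by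
  have hk := Lp.ker_toTemperedDistributionCLM_eq_bot (E := Eucl d) (F := ℂ)
    (μ := volume) (p := 2)
  exact (LinearMap.ker_eq_bot.mp hk) h

/-- The elements of the Sobolev space `H^s(ℝ^d)`, `s ≥ 0`, as a subspace of `L²(ℝ^d)`:
those `u` with `𝓕⁻ (1 + |ξ|²)^(s/2) 𝓕 u ∈ L²`. -/
def sobolevSubmodule (d : ℕ) (s : ℝ) : Submodule ℂ (L2 d) where
  carrier := {u | MemSobolev s 2 (u : 𝓢'(Eucl d, ℂ))}
  add_mem' {u v} hu hv := by
    have h := hu.add hv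
    simp only [← Lp.toTemperedDistributionCLM_apply] at h
    simpa only [Set.mem_ofPred_eq, ← Lp.toTemperedDistributionCLM_apply, map_add] using h
  zero_mem' := by
    simp only [Set.mem_ofPred_eq, ← Lp.toTemperedDistributionCLM_apply, map_zero]
    exact memSobolev_fun_zero _ _ s 2
  smul_mem' c u hu := by
    have h := MemSobolev.smul c hu
    simp only [← Lp.toTemperedDistributionCLM_apply] at h
    simpa only [Set.mem_ofPred_eq, ← Lp.toTemperedDistributionCLM_apply, map_smul] using h

/-- The Sobolev space `H^s(ℝ^d)`, `s ≥ 0`, as a type of its own; it does not carry the norm of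
`L²(ℝ^d)` but the Sobolev norm defined below. -/
def HSob (d : ℕ) (s : ℝ) : Type := sobolevSubmodule d s

namespace HSob

variable {d : ℕ} {s : ℝ}

instance : AddCommGroup (HSob d s) := inferInstanceAs (AddCommGroup (sobolevSubmodule d s))

instance : Module ℂ (HSob d s) := inferInstanceAs (Module ℂ (sobolevSubmodule d s))

/-- The inclusion `H^s(ℝ^d) → L²(ℝ^d)`. -/
def toL2 : HSob d s →ₗ[ℂ] L2 d := (sobolevSubmodule d s).subtype

theorem memSobolev (u : HSob d s) : MemSobolev s 2 (toL2 u : 𝓢'(Eucl d, ℂ)) := u.2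

/-- The Bessel potential `J^s u = 𝓕⁻ (1 + |ξ|²)^(s/2) 𝓕 u` of `u ∈ H^s(ℝ^d)`, as a function
in `L²(ℝ^d)`. -/
def bessel : HSob d s →ₗ[ℂ] L2 d where
  toFun u := u.memSobolev.choose
  map_add' u v := by
    apply L2.toTemperedDistribution_injective
    rw [← (u + v).memSobolev.choose_spec]
    simp only [← Lp.toTemperedDistributionCLM_apply, map_add]
    simp only [Lp.toTemperedDistributionCLM_apply]
    rw [← u.memSobolev.choose_spec, ← v.memSobolev.choose_spec]
  map_smul' c u := by
    apply L2.toTemperedDistribution_injective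
    rw [← (c • u).memSobolev.choose_spec]
    simp only [← Lp.toTemperedDistributionCLM_apply, map_smul, RingHom.id_apply]
    simp only [Lp.toTemperedDistributionCLM_apply]
    rw [← u.memSobolev.choose_spec]

theorem besselPotential_toL2 (u : HSob d s) :
    besselPotential (Eucl d) ℂ s (toL2 u : 𝓢'(Eucl d, ℂ)) = (bessel u : 𝓢'(Eucl d, ℂ)) :=
  u.memSobolev.choose_spec

theorem bessel_injective : Function.Injective (bessel : HSob d s →ₗ[ℂ] L2 d) := by
  intro u v h
  have h1 : besselPotential (Eucl d) ℂ s (toL2 u : 𝓢'(Eucl d, ℂ)) =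
      besselPotential (Eucl d) ℂ s (toL2 v : 𝓢'(Eucl d, ℂ)) := by
    rw [besselPotential_toL2, besselPotential_toL2, h]
  have h2 := congrArg (besselPotential (Eucl d) ℂ (-s)) h1
  simp only [besselPotential_besselPotential_apply, add_neg_cancel, besselPotential_zero,
    ContinuousLinearMap.id_apply] at h2
  exact Subtype.ext (L2.toTemperedDistribution_injective h2)

/-- The Sobolev norm `‖u‖_{H^s} = ‖𝓕⁻ (1 + |ξ|²)^(s/2) 𝓕 u‖_{L²}`. -/
instance : NormedAddCommGroup (HSob d s) :=
  NormedAddCommGroup.induced (HSob d s) (L2 d) bessel bessel_injective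

theorem norm_eq (u : HSob d s) : ‖u‖ = ‖bessel u‖ := rfl

instance : NormedSpace ℂ (HSob d s) := NormedSpace.induced ℂ (HSob d s) (L2 d) bessel

end HSob

/-- `W ∈ L^p(ℝ^d) + L^q(ℝ^d)`. -/
def MemLpAdd {d : ℕ} (W : Eucl d → ℂ) (p q : ℝ≥0∞) : Prop :=
  ∃ W₁ W₂ : Eucl d → ℂ, MemLp W₁ p volume ∧ MemLp W₂ q volume ∧ W =ᵐ[volume] W₁ + W₂

/-- The convolution `(W ∗ g)(x) = ∫ W(y) g(x - y) dy` exists at every `x`. -/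
def ConvExists {d : ℕ} (W : Eucl d → ℂ) (g : Eucl d → ℝ) : Prop :=
  ConvolutionExists W (fun y => (g y : ℂ)) (ContinuousLinearMap.mul ℂ ℂ) volume

/-- The convolution `(W ∗ g)(x) = ∫ W(y) g(x - y) dy`. -/
def conv {d : ℕ} (W : Eucl d → ℂ) (g : Eucl d → ℝ) : Eucl d → ℂ :=
  W ⋆[ContinuousLinearMap.mul ℂ ℂ, volume] (fun y => (g y : ℂ))

/-- The function `|u|²`. -/
def absSq {d : ℕ} (u : Eucl d → ℂ) : Eucl d → ℝ := fun x => ‖u x‖ ^ 2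

/-- The function `Re(u* v)`. -/
def reConjMul {d : ℕ} (u v : Eucl d → ℂ) : Eucl d → ℝ := fun x => (conj (u x) * v x).re

/-- The Hartree nonlinearity `(W ∗ |u|²) u`. -/
def hartree {d : ℕ} (W u : Eucl d → ℂ) : Eucl d → ℂ := fun x => conv W (absSq u) x * u x

/-- The function `(W ∗ |u|²) v + 2 (W ∗ Re(u* v)) u`. -/
def hartreeDeriv {d : ℕ} (W u v : Eucl d → ℂ) : Eucl d → ℂ := fun x =>
  conv W (absSq u) x * v x + 2 * conv W (reConjMul u v) x * u x

/-- The differentiability condition on a nonlinearity `B : H₁ → H₁` and a map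
`B' : H₁ → 𝓑(H₀)`, where `ι` is the inclusion of `H₁` in `H₀`: for `R, ε > 0` there are
`C, δ > 0` with `‖B'(u)‖ ≤ C` and `‖B(u + w) - B(u) - B'(u) w‖_{H₀} ≤ ε ‖w‖_{H₀}` whenever
`‖u‖_{H₁} ≤ R` and `‖w‖_{H₁} < δ`. The operators in `𝓑(H₀)` are bounded and real-linear. -/
def DerivCondition {H₁ H₀ : Type*} [NormedAddCommGroup H₁] [NormedSpace ℂ H₁]
    [NormedAddCommGroup H₀] [NormedSpace ℂ H₀] [NormedSpace ℝ H₀] [IsScalarTower ℝ ℂ H₀]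
    (ι : H₁ →ₗ[ℂ] H₀) (B : H₁ → H₁) (B' : H₁ → (H₀ →L[ℝ] H₀)) : Prop :=
  ∀ R > (0 : ℝ), ∀ ε > (0 : ℝ), ∃ C > (0 : ℝ), ∃ δ > (0 : ℝ),
    ∀ u w : H₁, ‖u‖ ≤ R → ‖w‖ < δ →
      ‖B' u‖ ≤ C ∧ ‖ι (B (u + w)) - ι (B u) - B' u (ι w)‖ ≤ ε * ‖ι w‖

end

/-!
`H^s` is described by forward differences in the coordinate directions. By Plancherel and the
homogeneity of `x ↦ ∫₀^∞ |e^{2πitx} - 1|^{2n} t^{-1-2s} dt`, a function `f ∈ L²` belongs to `H^s`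
if and only if `∫₀^∞ ‖Δ_{te}^n f‖²_{L²} t^{-1-2s} dt` is finite for every coordinate direction `e`,
whatever the integer `n > s`.

Differences commute with `W ∗ ·` and obey a Leibniz rule. Hence, when `3m` of them are applied to
`(W ∗ |u|²) u`, at least `m` fall on one and the same factor `u`. That factor is measured in `L²`
and the other two in `L² ∩ L^∞`, into which `H^s` embeds since `s > d/2`, while
`W ∈ L^∞ + L^p ⊆ L^∞ + L²` convolves `L¹ ∩ L²` boundedly into `L^∞`. The comparison of the
`3m`-th differences of `(W ∗ |u|²) u` with the `m`-th differences of `u` gives `B(u) ∈ H^s`.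

The same `L²` and `L^∞` estimates bound `B'(u)` on `L²`, and, `B` being trilinear, the remainder
`B(u + w) - B(u) - B'(u) w` by a multiple of `‖w‖_{H^s} (‖u‖_{H^s} + ‖w‖_{H^s}) ‖w‖_{L²}`.
-/

open scoped fwdDiff FourierTransform NNReal

section Bilinear

variable {𝕜 E F G : Type*} [NontriviallyNormedField 𝕜] [NormedAddCommGroup E] [NormedSpace 𝕜 E]
  [NormedAddCommGroup F] [NormedSpace 𝕜 F] [NormedAddCommGroup G] [NormedSpace 𝕜 G]

theorem eLpNorm_bilin_le (B : E →L[𝕜] F →L[𝕜] G) {α : Type*} [MeasurableSpace α]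
    {μ : Measure α} {f : α → E} {g : α → F}
    (hf : AEStronglyMeasurable f μ) (hg : AEStronglyMeasurable g μ) (p q : ℝ≥0∞) {r : ℝ≥0∞}
    [ENNReal.HolderTriple p q r] :
    eLpNorm (fun x => B (f x) (g x)) r μ ≤ ‖B‖ₑ * eLpNorm f p μ * eLpNorm g q μ :=
  eLpNorm_le_eLpNorm_mul_eLpNorm_of_nnnorm hf hg (fun a b => B a b) ‖B‖₊ <|
    .of_forall fun x => B.le_opNorm₂ (f x) (g x)

theorem fwdDiff_bilin (B : E →L[𝕜] F →L[𝕜] G) {M : Type*} [AddCommMonoid M]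
    (f : M → E) (g : M → F) (h : M) :
    Δ_[h] (fun x => B (f x) (g x)) =
      (fun x => B (Δ_[h] f x) (g (x + h))) + fun x => B (f x) (Δ_[h] g x) := by
  ext x
  simp [fwdDiff]

end Bilinear

section ForwardDifferences

variable {M : Type*} [AddCommMonoid M] [MeasurableSpace M] [MeasurableAdd M] {μ : Measure M}
  [μ.IsAddRightInvariant]

theorem ae_eq_comp_add_right {β : Type*} {f g : M → β} (hfg : f =ᵐ[μ] g) (h : M) :
    (fun x => f (x + h)) =ᵐ[μ] fun x => g (x + h) :=
  (measurePreserving_add_right μ h).quasiMeasurePreserving.ae_eq_comp hfg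

variable {E F G : Type*} [NormedAddCommGroup E] [NormedAddCommGroup F] [NormedAddCommGroup G]

theorem aestronglyMeasurable_comp_add_right {f : M → E} (hf : AEStronglyMeasurable f μ) (h : M) :
    AEStronglyMeasurable (fun x => f (x + h)) μ :=
  hf.comp_measurePreserving (measurePreserving_add_right μ h)

theorem eLpNorm_comp_add_right {f : M → E} (hf : AEStronglyMeasurable f μ) (p : ℝ≥0∞) (h : M) :
    eLpNorm (fun x => f (x + h)) p μ = eLpNorm f p μ :=
  eLpNorm_comp_measurePreserving hf (measurePreserving_add_right μ h)

theorem fwdDiff_iter_congr_ae {f g : M → E} (hfg : f =ᵐ[μ] g) (h : M) (n : ℕ) :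
    Δ_[h] ^[n] f =ᵐ[μ] Δ_[h] ^[n] g := by
  induction n generalizing f g with
  | zero => exact hfg
  | succ _ ih => exact ih ((ae_eq_comp_add_right hfg h).sub hfg)

theorem aestronglyMeasurable_fwdDiff_iter {f : M → E} (hf : AEStronglyMeasurable f μ) (h : M)
    (n : ℕ) : AEStronglyMeasurable (Δ_[h] ^[n] f) μ := by
  induction n generalizing f with
  | zero => exact hf
  | succ _ ih => exact ih ((aestronglyMeasurable_comp_add_right hf h).sub hf)

theorem eLpNorm_fwdDiff_iter_comp_add_right {f : M → E} (hf : AEStronglyMeasurable f μ)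
    (p : ℝ≥0∞) (h : M) (n : ℕ) :
    eLpNorm (Δ_[h] ^[n] fun x => f (x + h)) p μ = eLpNorm (Δ_[h] ^[n] f) p μ := by
  rw [← eLpNorm_comp_add_right (aestronglyMeasurable_fwdDiff_iter hf h n) p h]
  congr 1
  ext x
  exact fwdDiff_iter_comp_add h f h n x

theorem eLpNorm_fwdDiff_le {f : M → E} (hf : AEStronglyMeasurable f μ) {p : ℝ≥0∞} (hp : 1 ≤ p)
    (h : M) : eLpNorm (Δ_[h] f) p μ ≤ 2 * eLpNorm f p μ :=
  calc eLpNorm (Δ_[h] f) p μ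
      ≤ eLpNorm (fun x => f (x + h)) p μ + eLpNorm f p μ :=
        eLpNorm_sub_le (aestronglyMeasurable_comp_add_right hf h) hf hp
    _ = 2 * eLpNorm f p μ := by rw [eLpNorm_comp_add_right hf, two_mul]

theorem eLpNorm_fwdDiff_iter_le {f : M → E} (hf : AEStronglyMeasurable f μ) {p : ℝ≥0∞}
    (hp : 1 ≤ p) (h : M) (n : ℕ) : eLpNorm (Δ_[h] ^[n] f) p μ ≤ 2 ^ n * eLpNorm f p μ := by
  induction n generalizing f with
  | zero => simp
  | succ n ih =>
    calc eLpNorm (Δ_[h] ^[n] (Δ_[h] f)) p μ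
        ≤ 2 ^ n * eLpNorm (Δ_[h] f) p μ := ih (aestronglyMeasurable_fwdDiff_iter hf h 1)
      _ ≤ 2 ^ n * (2 * eLpNorm f p μ) := by gcongr; exact eLpNorm_fwdDiff_le hf hp h
      _ = 2 ^ (n + 1) * eLpNorm f p μ := by ring

theorem memLp_fwdDiff_iter {f : M → E} {p : ℝ≥0∞} (hf : MemLp f p μ) (h : M) (n : ℕ) :
    MemLp (Δ_[h] ^[n] f) p μ := by
  induction n generalizing f with
  | zero => exact hf
  | succ _ ih => exact ih ((hf.comp_measurePreserving (measurePreserving_add_right μ h)).sub hf)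

variable {𝕜 : Type*} [NontriviallyNormedField 𝕜] [NormedSpace 𝕜 E] [NormedSpace 𝕜 F]
  [NormedSpace 𝕜 G]

theorem eLpNorm_fwdDiff_iter_bilin_le (B : E →L[𝕜] F →L[𝕜] G) {f : M → E} {g : M → F}
    (hf : AEStronglyMeasurable f μ) (hg : AEStronglyMeasurable g μ) (p q : ℝ≥0∞) {r : ℝ≥0∞}
    [ENNReal.HolderTriple p q r] (hr : 1 ≤ r) (h : M) (n : ℕ) :
    eLpNorm (Δ_[h] ^[n] fun x => B (f x) (g x)) r μ ≤
      3 ^ n * ‖B‖ₑ * (eLpNorm f p μ * eLpNorm g q μ) :=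
  calc eLpNorm (Δ_[h] ^[n] fun x => B (f x) (g x)) r μ
      ≤ 2 ^ n * eLpNorm (fun x => B (f x) (g x)) r μ :=
        eLpNorm_fwdDiff_iter_le (B.aestronglyMeasurable_comp₂ hf hg) hr h n
    _ ≤ 3 ^ n * (‖B‖ₑ * eLpNorm f p μ * eLpNorm g q μ) := by
        gcongr
        · norm_num
        · exact eLpNorm_bilin_le B hf hg p q
    _ = 3 ^ n * ‖B‖ₑ * (eLpNorm f p μ * eLpNorm g q μ) := by ring

theorem eLpNorm_fwdDiff_iter_succ_bilin_le (B : E →L[𝕜] F →L[𝕜] G) {f : M → E} {g : M → F}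
    (hf : AEStronglyMeasurable f μ) (hg : AEStronglyMeasurable g μ) {r : ℝ≥0∞} (hr : 1 ≤ r)
    (h : M) (n : ℕ) :
    eLpNorm (Δ_[h] ^[n + 1] fun x => B (f x) (g x)) r μ ≤
      eLpNorm (Δ_[h] ^[n] fun x => B (Δ_[h] f x) (g (x + h))) r μ +
        eLpNorm (Δ_[h] ^[n] fun x => B (f x) (Δ_[h] g x)) r μ := by
  rw [Function.iterate_succ_apply, fwdDiff_bilin, fwdDiff_iter_add]
  exact eLpNorm_add_le
    (aestronglyMeasurable_fwdDiff_iter (B.aestronglyMeasurable_comp₂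
      (aestronglyMeasurable_fwdDiff_iter hf h 1) (aestronglyMeasurable_comp_add_right hg h)) h n)
    (aestronglyMeasurable_fwdDiff_iter (B.aestronglyMeasurable_comp₂ hf
      (aestronglyMeasurable_fwdDiff_iter hg h 1)) h n) hr

/-- The Kato–Ponce inequality for differences. By the Leibniz rule each of the `m + l` differences
falls on one of the two factors, so either `f` receives `m` of them or `g` receives `l`. -/
theorem eLpNorm_fwdDiff_iter_add_bilin_le (B : E →L[𝕜] F →L[𝕜] G) {f : M → E} {g : M → F}
    (hf : AEStronglyMeasurable f μ) (hg : AEStronglyMeasurable g μ) (p q p' q' : ℝ≥0∞)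
    {r : ℝ≥0∞} [ENNReal.HolderTriple p q r] [ENNReal.HolderTriple p' q' r] (hr : 1 ≤ r)
    (h : M) (m l : ℕ) :
    eLpNorm (Δ_[h] ^[m + l] fun x => B (f x) (g x)) r μ ≤ 3 ^ (m + l) * ‖B‖ₑ *
      (eLpNorm (Δ_[h] ^[m] f) p μ * eLpNorm g q μ +
        eLpNorm f p' μ * eLpNorm (Δ_[h] ^[l] g) q' μ) := by
  induction m generalizing f g l with
  | zero =>
    refine (eLpNorm_fwdDiff_iter_bilin_le B hf hg p q hr h (0 + l)).trans ?_
    gcongr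
    exact le_self_add
  | succ m ihm =>
    induction l generalizing f g with
    | zero =>
      refine (eLpNorm_fwdDiff_iter_bilin_le B hf hg p' q' hr h (m + 1 + 0)).trans ?_
      gcongr
      exact le_add_self
    | succ l ihl =>
      have hΔf : AEStronglyMeasurable (Δ_[h] f) μ := aestronglyMeasurable_fwdDiff_iter hf h 1
      have hΔg : AEStronglyMeasurable (Δ_[h] g) μ := aestronglyMeasurable_fwdDiff_iter hg h 1
      have norm_Δf := eLpNorm_fwdDiff_le hf (hr.trans (ENNReal.HolderTriple.le p' q' r)) h
      have norm_Δg := eLpNorm_fwdDiff_le hg (hr.trans (ENNReal.HolderTriple.le q p r)) h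
      have diff_left := ihm hΔf (aestronglyMeasurable_comp_add_right hg h) (l + 1)
      have diff_right := ihl hf hΔg
      rw [eLpNorm_comp_add_right hg, eLpNorm_fwdDiff_iter_comp_add_right hg, ← add_assoc m l 1,
        ← Function.iterate_succ_apply] at diff_left
      rw [← Function.iterate_succ_apply, add_right_comm m 1 l] at diff_right
      set X := eLpNorm (Δ_[h] ^[m + 1] f) p μ
      set Y := eLpNorm (Δ_[h] ^[l + 1] g) q' μ
      rw [show m + 1 + (l + 1) = m + l + 1 + 1 by ring]
      calc _ ≤ _ := eLpNorm_fwdDiff_iter_succ_bilin_le B hf hg hr h (m + l + 1)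
        _ ≤ 3 ^ (m + l + 1) * ‖B‖ₑ * (X * eLpNorm g q μ + 2 * eLpNorm f p' μ * Y) +
            3 ^ (m + l + 1) * ‖B‖ₑ * (X * (2 * eLpNorm g q μ) + eLpNorm f p' μ * Y) := by
          refine add_le_add (diff_left.trans ?_) (diff_right.trans ?_) <;> gcongr
        _ = 3 ^ (m + l + 1 + 1) * ‖B‖ₑ * (X * eLpNorm g q μ + eLpNorm f p' μ * Y) := by ring

end ForwardDifferences

section FourierL2

theorem iteratedDeriv_cexp_ofReal_mul (c : ℂ) (n : ℕ) :
    iteratedDeriv n (fun t : ℝ => Complex.exp (t * c)) =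
      fun t : ℝ => c ^ n * Complex.exp (t * c) := by
  induction n with
  | zero => simp
  | succ n ih =>
    ext t
    have hexp : HasDerivAt (fun t : ℝ => Complex.exp (t * c)) (Complex.exp (t * c) * (1 * c)) t :=
      (Complex.ofRealCLM.hasDerivAt.mul_const c).cexp
    rw [iteratedDeriv_succ, ih, (hexp.const_mul (c ^ n)).deriv]
    ring

theorem hasTemperateGrowth_fourierChar :
    (fun t : ℝ => (Real.fourierChar t : ℂ)).HasTemperateGrowth := by
  have hexp : (fun t : ℝ => (Real.fourierChar t : ℂ)) =
      fun t : ℝ => Complex.exp (t * (2 * Real.pi * Complex.I)) := by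
    ext t
    rw [Real.fourierChar_apply]
    push_cast
    ring_nf
  refine ⟨hexp ▸ (Complex.ofRealCLM.contDiff.mul contDiff_const).cexp,
    fun n => ⟨0, (2 * Real.pi) ^ n, fun t => le_of_eq ?_⟩⟩
  rw [norm_iteratedFDeriv_eq_norm_iteratedDeriv, hexp, iteratedDeriv_cexp_ofReal_mul]
  rw [norm_mul, norm_pow, ← congrFun hexp t, Circle.norm_coe]
  simp [abs_of_pos Real.pi_pos]

variable {V F : Type*} [NormedAddCommGroup V] [InnerProductSpace ℝ V]

theorem hasTemperateGrowth_fourierChar_inner (h : V) :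
    (fun ξ : V => (Real.fourierChar (inner ℝ h ξ) : ℂ)).HasTemperateGrowth :=
  hasTemperateGrowth_fourierChar.comp (Function.hasTemperateGrowth_inner_right h)

variable [FiniteDimensional ℝ V] [MeasurableSpace V] [BorelSpace V]

theorem fourier_fourierChar_smul [NormedAddCommGroup F] [NormedSpace ℂ F] (f : V → F) (h x : V) :
    𝓕 (fun ξ => (Real.fourierChar (inner ℝ h ξ) : ℂ) • f ξ) x = 𝓕 f (x - h) := by
  simp only [Real.fourier_eq]
  congr 1
  ext ξ
  rw [← Circle.smul_def, smul_smul, ← AddChar.map_add_eq_mul, inner_sub_right,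
    real_inner_comm ξ h, neg_sub, sub_eq_neg_add]

theorem ae_eq_of_forall_integral_schwartz_smul_eq [NormedAddCommGroup F] [NormedSpace ℂ F]
    [CompleteSpace F] {f g : V → F} (hf : LocallyIntegrable f volume)
    (hg : LocallyIntegrable g volume) (h : ∀ φ : 𝓢(V, ℂ), ∫ x, φ x • f x = ∫ x, φ x • g x) :
    f =ᵐ[volume] g := by
  refine ae_eq_of_integral_contDiff_smul_eq hf hg fun φ hφ hφ' => ?_
  have hφℂ : HasCompactSupport fun x => (φ x : ℂ) := hφ'.comp_left Complex.ofReal_zero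
  simp_rw [← Complex.coe_smul]
  exact h (hφℂ.toSchwartzMap (Complex.ofRealCLM.contDiff.comp hφ))

theorem smulLeftCLM_toTemperedDistribution_eq_iff [NormedAddCommGroup F] [NormedSpace ℂ F]
    [CompleteSpace F] {p q : ℝ≥0∞} [Fact (1 ≤ p)] [Fact (1 ≤ q)] {m : V → ℂ}
    (hm : m.HasTemperateGrowth) (f : Lp F p (volume : Measure V))
    (g : Lp F q (volume : Measure V)) :
    smulLeftCLM F m (f : 𝓢'(V, F)) = g ↔ g =ᵐ[volume] fun x => m x • f x := by
  have pairing_left (φ : 𝓢(V, ℂ)) :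
      smulLeftCLM F m (f : 𝓢'(V, F)) φ = ∫ x, φ x • (m x • f x) := by
    rw [smulLeftCLM_apply_apply, Lp.toTemperedDistribution_apply]
    refine integral_congr_ae (.of_forall fun x => ?_)
    simp only [SchwartzMap.smulLeftCLM_apply_apply hm, smul_eq_mul, smul_smul, mul_comm]
  constructor
  · intro h
    refine ae_eq_of_forall_integral_schwartz_smul_eq ((Lp.memLp g).locallyIntegrable Fact.out)
      (((Lp.memLp f).locallyIntegrable Fact.out).continuous_smul hm.1.continuous) fun φ => ?_
    rw [← pairing_left, ← Lp.toTemperedDistribution_apply, h]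
  · intro h
    ext φ
    rw [pairing_left, Lp.toTemperedDistribution_apply]
    exact integral_congr_ae (by filter_upwards [h] with x hx; rw [hx])

variable [NormedAddCommGroup F] [InnerProductSpace ℂ F] [CompleteSpace F]

theorem fourier_compMeasurePreserving_add_right (h : V) (f : Lp F 2 (volume : Measure V)) :
    (𝓕 (Lp.compMeasurePreserving (· + h) (measurePreserving_add_right volume h) f) :
        Lp F 2 (volume : Measure V)) =ᵐ[volume]
      fun ξ => (Real.fourierChar (inner ℝ h ξ) : ℂ) • (𝓕 f : Lp F 2 (volume : Measure V)) ξ := by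
  have he := hasTemperateGrowth_fourierChar_inner h
  rw [← smulLeftCLM_toTemperedDistribution_eq_iff he]
  ext φ
  set ψ := SchwartzMap.smulLeftCLM ℂ (fun ξ : V => (Real.fourierChar (inner ℝ h ξ) : ℂ)) φ
  have fourier_ψ (x : V) : 𝓕 ψ x = 𝓕 φ (x - h) := by
    rw [SchwartzMap.fourier_coe, SchwartzMap.smulLeftCLM_apply he]
    exact fourier_fourierChar_smul φ h x
  rw [smulLeftCLM_apply_apply, ← Lp.fourier_toTemperedDistribution_eq,
    ← Lp.fourier_toTemperedDistribution_eq, TemperedDistribution.fourier_apply,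
    TemperedDistribution.fourier_apply, Lp.toTemperedDistribution_apply,
    Lp.toTemperedDistribution_apply, ← integral_add_right_eq_self _ h]
  refine integral_congr_ae ?_
  filter_upwards [Lp.coeFn_compMeasurePreserving f (measurePreserving_add_right volume h)] with x hx
  rw [hx, fourier_ψ, add_sub_cancel_right, Function.comp_apply]

theorem exists_fwdDiff_iter_and_fourier (h : V) (f : Lp F 2 (volume : Measure V)) (n : ℕ) :
    ∃ g : Lp F 2 (volume : Measure V), g =ᵐ[volume] Δ_[h] ^[n] f ∧
      (𝓕 g : Lp F 2 (volume : Measure V)) =ᵐ[volume] fun ξ =>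
        ((Real.fourierChar (inner ℝ h ξ) : ℂ) - 1) ^ n • (𝓕 f : Lp F 2 (volume : Measure V)) ξ := by
  induction n with
  | zero => exact ⟨f, by simp, by simp⟩
  | succ n ih =>
    obtain ⟨g, hg, fourier_g⟩ := ih
    set τg := Lp.compMeasurePreserving (· + h) (measurePreserving_add_right volume h) g
    refine ⟨τg - g, ?_, ?_⟩
    · filter_upwards [Lp.coeFn_sub τg g, hg, ae_eq_comp_add_right hg h,
        Lp.coeFn_compMeasurePreserving g (measurePreserving_add_right volume h)]
        with x hsub hgx hgxh hτ
      rw [hsub, Pi.sub_apply, hτ, Function.comp_apply, hgxh, hgx, Function.iterate_succ_apply',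
        fwdDiff]
    · rw [show 𝓕 (τg - g) = 𝓕 τg - 𝓕 g from map_sub (Lp.fourierTransformₗᵢ V F) τg g]
      filter_upwards [Lp.coeFn_sub (𝓕 τg) (𝓕 g), fourier_g,
        fourier_compMeasurePreserving_add_right h g] with ξ hsub hgξ hτ
      rw [hsub, Pi.sub_apply, hτ, hgξ, smul_smul, ← sub_smul, ← sub_one_mul, ← pow_succ']

theorem lintegral_enorm_sq_eq {α E : Type*} [MeasurableSpace α] {μ : Measure α}
    [NormedAddCommGroup E] (f : α → E) :
    ∫⁻ x, ‖f x‖ₑ ^ 2 ∂μ = eLpNorm f 2 μ ^ 2 := by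
  rw [eLpNorm_eq_lintegral_rpow_enorm_toReal (by simp) (by simp), ← ENNReal.rpow_natCast,
    ← ENNReal.rpow_mul]
  simp

theorem eLpNorm_fwdDiff_iter_sq (h : V) (f : Lp F 2 (volume : Measure V)) (n : ℕ) :
    eLpNorm (Δ_[h] ^[n] f) 2 volume ^ 2 =
      ∫⁻ ξ, ‖(Real.fourierChar (inner ℝ h ξ) : ℂ) - 1‖ₑ ^ (2 * n) *
        ‖(𝓕 f : Lp F 2 (volume : Measure V)) ξ‖ₑ ^ 2 := by
  obtain ⟨g, hg, fourier_g⟩ := exists_fwdDiff_iter_and_fourier h f n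
  have plancherel : eLpNorm g 2 volume = eLpNorm (𝓕 g : Lp F 2 (volume : Measure V)) 2 volume := by
    rw [← Lp.enorm_def, ← Lp.enorm_def, ← ofReal_norm, ← ofReal_norm, Lp.norm_fourier_eq]
  rw [← eLpNorm_congr_ae hg, plancherel, ← lintegral_enorm_sq_eq]
  refine lintegral_congr_ae ?_
  filter_upwards [fourier_g] with ξ hξ
  rw [hξ, enorm_smul, enorm_pow, mul_pow, ← pow_mul, mul_comm n]

end FourierL2

section Sobolev

theorem enorm_one_add_norm_sq_rpow_half_sq {V : Type*} [NormedAddCommGroup V] (s : ℝ)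
    (ξ : V) :
    ‖(((1 + ‖ξ‖ ^ 2) ^ (s / 2) : ℝ) : ℂ)‖ₑ ^ 2 = ENNReal.ofReal ((1 + ‖ξ‖ ^ 2) ^ s) := by
  rw [← ofReal_norm, Complex.norm_real, Real.norm_of_nonneg (by positivity),
    ← ENNReal.ofReal_pow (by positivity), ← Real.rpow_mul_natCast (by positivity)]
  congr 2
  push_cast
  ring

theorem continuous_one_add_norm_sq_rpow {V : Type*} [NormedAddCommGroup V] (s : ℝ) :
    Continuous fun ξ : V => (((1 + ‖ξ‖ ^ 2) ^ s : ℝ) : ℂ) :=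
  Complex.continuous_ofReal.comp (Continuous.rpow_const (by fun_prop) fun ξ => .inl (by positivity))

variable {V F : Type*} [NormedAddCommGroup V] [InnerProductSpace ℝ V] [FiniteDimensional ℝ V]
  [MeasurableSpace V] [BorelSpace V] [NormedAddCommGroup F] [InnerProductSpace ℂ F]
  [CompleteSpace F]

theorem besselPotential_eq_iff (s : ℝ) (f g : Lp F 2 (volume : Measure V)) :
    besselPotential V F s (f : 𝓢'(V, F)) = g ↔
      (𝓕 g : Lp F 2 (volume : Measure V)) =ᵐ[volume] fun ξ =>
        (((1 + ‖ξ‖ ^ 2) ^ (s / 2) : ℝ) : ℂ) • (𝓕 f : Lp F 2 (volume : Measure V)) ξ := by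
  have fourier_injective : Function.Injective (𝓕 : 𝓢'(V, F) → 𝓢'(V, F)) :=
    Function.LeftInverse.injective (g := 𝓕⁻) FourierTransform.fourierInv_fourier_eq
  rw [← fourier_injective.eq_iff, fourier_besselPotential_eq_smulLeftCLM_fourier_apply,
    Lp.fourier_toTemperedDistribution_eq, Lp.fourier_toTemperedDistribution_eq,
    smulLeftCLM_toTemperedDistribution_eq_iff (by fun_prop)]

theorem memSobolev_two_iff_lintegral_fourier_lt_top {s : ℝ} (f : Lp F 2 (volume : Measure V)) :
    MemSobolev s 2 (f : 𝓢'(V, F)) ↔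
      ∫⁻ ξ, ENNReal.ofReal ((1 + ‖ξ‖ ^ 2) ^ s) *
        ‖(𝓕 f : Lp F 2 (volume : Measure V)) ξ‖ₑ ^ 2 < ∞ := by
  set G : V → F := fun ξ =>
    (((1 + ‖ξ‖ ^ 2) ^ (s / 2) : ℝ) : ℂ) • (𝓕 f : Lp F 2 (volume : Measure V)) ξ with hG
  have G_meas : AEStronglyMeasurable G volume :=
    (continuous_one_add_norm_sq_rpow (s / 2)).aestronglyMeasurable.smul (Lp.memLp _).1
  have memSobolev_iff : MemSobolev s 2 (f : 𝓢'(V, F)) ↔ MemLp G 2 volume := by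
    constructor
    · rintro ⟨g, hg⟩
      exact (Lp.memLp _).ae_eq ((besselPotential_eq_iff s f g).1 hg)
    · intro hG
      refine ⟨𝓕⁻ (hG.toLp G), (besselPotential_eq_iff s f _).2 ?_⟩
      rw [FourierTransform.fourier_fourierInv_eq]
      exact hG.coeFn_toLp
  have lintegral_eq : ∫⁻ ξ, ENNReal.ofReal ((1 + ‖ξ‖ ^ 2) ^ s) *
      ‖(𝓕 f : Lp F 2 (volume : Measure V)) ξ‖ₑ ^ 2 = eLpNorm G 2 volume ^ 2 := by
    simp only [← lintegral_enorm_sq_eq, hG, enorm_smul, mul_pow,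
      enorm_one_add_norm_sq_rpow_half_sq]
  rw [memSobolev_iff, lintegral_eq, MemLp, and_iff_right G_meas, ENNReal.pow_lt_top_iff]
  simp

theorem ae_eq_fourierInv_fourier {f : Lp F 2 (volume : Measure V)}
    (hf : Integrable (𝓕 f : Lp F 2 (volume : Measure V)) volume) :
    f =ᵐ[volume] 𝓕⁻ ((𝓕 f : Lp F 2 (volume : Measure V)) : V → F) := by
  have inner_continuous : Continuous fun p : V × V => (-innerₗ V) p.1 p.2 := by
    simp only [LinearMap.neg_apply, innerₗ_apply_apply]
    fun_prop
  have fourierInv_continuous : Continuous (𝓕⁻ ((𝓕 f : Lp F 2 (volume : Measure V)) : V → F)) :=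
    VectorFourier.fourierIntegral_continuous Real.continuous_fourierChar inner_continuous hf
  refine ae_eq_of_forall_integral_schwartz_smul_eq ((Lp.memLp f).locallyIntegrable one_le_two)
    fourierInv_continuous.locallyIntegrable fun φ => ?_
  calc ∫ x, φ x • f x = (𝓕 (f : 𝓢'(V, F))) (𝓕⁻ φ) := by
        rw [TemperedDistribution.fourier_apply, FourierTransform.fourier_fourierInv_eq,
          Lp.toTemperedDistribution_apply]
    _ = ∫ ξ, 𝓕⁻ (φ : V → ℂ) ξ • (𝓕 f : Lp F 2 (volume : Measure V)) ξ := by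
        rw [Lp.fourier_toTemperedDistribution_eq, Lp.toTemperedDistribution_apply,
          SchwartzMap.fourierInv_coe]
    _ = ∫ x, φ x • 𝓕⁻ ((𝓕 f : Lp F 2 (volume : Measure V)) : V → F) x := by
        have flip_inner : (-innerₗ V).flip = -innerₗ V := by
          ext x y
          simp [real_inner_comm]
        have := VectorFourier.integral_fourierIntegral_smul_eq_flip (μ := volume) (ν := volume)
          Real.continuous_fourierChar inner_continuous φ.integrable hf
        rwa [flip_inner] at this

theorem eLpNorm_top_le_eLpNorm_fourier (f : Lp F 2 (volume : Measure V)) :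
    eLpNorm f ∞ volume ≤ eLpNorm (𝓕 f : Lp F 2 (volume : Measure V)) 1 volume := by
  rcases eq_or_ne (eLpNorm (𝓕 f : Lp F 2 (volume : Measure V)) 1 volume) ∞ with h | h
  · exact le_top.trans_eq h.symm
  have fourier_integrable : Integrable (𝓕 f : Lp F 2 (volume : Measure V)) volume :=
    memLp_one_iff_integrable.1 ⟨(Lp.memLp _).1, h.lt_top⟩
  rw [eLpNorm_congr_ae (ae_eq_fourierInv_fourier fourier_integrable),
    eLpNorm_one_eq_lintegral_enorm, ← ofReal_integral_norm_eq_lintegral_enorm fourier_integrable]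
  refine (eLpNorm_le_of_ae_bound (.of_forall fun x =>
    VectorFourier.norm_fourierIntegral_le_integral_norm _ _ _ _ _)).trans ?_
  simp

theorem memLp_one_add_norm_sq_rpow {s : ℝ} (hs : (Module.finrank ℝ V : ℝ) / 2 < s) :
    MemLp (fun ξ : V => (((1 + ‖ξ‖ ^ 2) ^ (-s / 2) : ℝ) : ℂ)) 2 volume := by
  refine ⟨(continuous_one_add_norm_sq_rpow (-s / 2)).aestronglyMeasurable, ?_⟩
  have weight_integrable := integrable_rpow_neg_one_add_norm_sq (μ := (volume : Measure V))
    (r := 2 * s) (by linarith)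
  refine (ENNReal.pow_lt_top_iff (n := 2)).1 ?_ |>.resolve_right two_ne_zero
  simp_rw [← lintegral_enorm_sq_eq, enorm_one_add_norm_sq_rpow_half_sq]
  convert weight_integrable.lintegral_lt_top using 5
  ring

end Sobolev

namespace HSob

variable {d : ℕ} {s : ℝ}

theorem fourier_toL2 (u : HSob d s) :
    (𝓕 (toL2 u) : L2 d) =ᵐ[volume]
      fun ξ => (((1 + ‖ξ‖ ^ 2) ^ (-s / 2) : ℝ) : ℂ) • (𝓕 (bessel u) : L2 d) ξ := by
  filter_upwards [(besselPotential_eq_iff s _ _).1 (besselPotential_toL2 u)] with ξ hξ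
  rw [hξ, smul_smul, ← Complex.ofReal_mul, ← Real.rpow_add (by positivity)]
  simp [neg_div]

theorem norm_toL2_le (hs : 0 ≤ s) (u : HSob d s) : ‖toL2 u‖ ≤ ‖u‖ := by
  rw [norm_eq, ← Lp.norm_fourier_eq, ← Lp.norm_fourier_eq (bessel u)]
  refine Lp.norm_le_norm_of_ae_le ?_
  filter_upwards [fourier_toL2 u] with ξ hξ
  rw [hξ, norm_smul, Complex.norm_real, Real.norm_of_nonneg (by positivity)]
  exact mul_le_of_le_one_left (norm_nonneg _)
    (Real.rpow_le_one_of_one_le_of_nonpos (by simp) (by linarith))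

theorem exists_eLpNorm_top_le (hs : (d : ℝ) / 2 < s) :
    ∃ C : ℝ≥0, ∀ u : HSob d s, eLpNorm (toL2 u) ∞ volume ≤ C * ‖u‖ₑ := by
  have weight_memLp := memLp_one_add_norm_sq_rpow (V := Eucl d) (s := s) (by simpa using hs)
  refine ⟨(eLpNorm (fun ξ : Eucl d => (((1 + ‖ξ‖ ^ 2) ^ (-s / 2) : ℝ) : ℂ)) 2 volume).toNNReal,
    fun u => (eLpNorm_top_le_eLpNorm_fourier _).trans ?_⟩
  rw [eLpNorm_congr_ae (fourier_toL2 u), ENNReal.coe_toNNReal weight_memLp.2.ne]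
  refine (eLpNorm_smul_le_mul_eLpNorm (p := 2) (q := 2) (r := 1)
    (Lp.memLp (𝓕 (bessel u) : L2 d)).1 weight_memLp.1).trans_eq ?_
  rw [← Lp.enorm_def, ← ofReal_norm, Lp.norm_fourier_eq, ← norm_eq, ofReal_norm]

end HSob

section DifferenceSymbol

theorem norm_fourierChar_sub_one (t : ℝ) :
    ‖(Real.fourierChar t : ℂ) - 1‖ = 2 * |Real.sin (Real.pi * t)| := by
  rw [Real.fourierChar_apply, mul_comm _ Complex.I, Complex.norm_exp_I_mul_ofReal_sub_one,
    norm_mul, Real.norm_ofNat, Real.norm_eq_abs, mul_assoc, mul_div_cancel_left₀ _ two_ne_zero]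

theorem measurable_enorm_fourierChar_sub_one :
    Measurable fun t : ℝ => ‖(Real.fourierChar t : ℂ) - 1‖ₑ := by
  simp only [← ofReal_norm, norm_fourierChar_sub_one]
  fun_prop

/-- The integral `∫₀^∞ |e^{2πitx} - 1|^{2n} t^{-1-2s} dt`, with value `∞` where it diverges. It is
the weight on the Fourier side of the squared `n`-th differences of a function, integrated over
the step size `t` against `t^{-1-2s} dt`. -/
noncomputable def diffSymbol (n : ℕ) (s x : ℝ) : ℝ≥0∞ :=
  ∫⁻ t in Set.Ioi (0 : ℝ), ‖(Real.fourierChar (t * x) : ℂ) - 1‖ₑ ^ (2 * n) *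
    ENNReal.ofReal (t ^ (-1 - 2 * s))

theorem diffSymbol_abs (n : ℕ) (s x : ℝ) : diffSymbol n s |x| = diffSymbol n s x := by
  rcases abs_choice x with h | h
  · rw [h]
  · simp [h, diffSymbol, ← ofReal_norm, norm_fourierChar_sub_one]

theorem diffSymbol_of_pos (n : ℕ) (s : ℝ) {x : ℝ} (hx : 0 < x) :
    diffSymbol n s x = ENNReal.ofReal (x ^ (2 * s)) * diffSymbol n s 1 := by
  have image_Ioi : (fun t => x * t) '' Set.Ioi 0 = Set.Ioi 0 := by
    rw [Set.image_mul_left_Ioi hx, mul_zero]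
  have rescale : diffSymbol n s 1 = ∫⁻ t in Set.Ioi (0 : ℝ), ENNReal.ofReal |x| *
      (‖(Real.fourierChar (x * t * 1) : ℂ) - 1‖ₑ ^ (2 * n) *
        ENNReal.ofReal ((x * t) ^ (-1 - 2 * s))) := by
    rw [← lintegral_image_eq_lintegral_abs_deriv_mul (f := fun t => x * t) measurableSet_Ioi
      (fun t _ => by simpa using (hasDerivWithinAt_id t _).const_mul x)
      (mul_right_injective₀ hx.ne').injOn
      (fun t => ‖(Real.fourierChar (t * 1) : ℂ) - 1‖ₑ ^ (2 * n) *
        ENNReal.ofReal (t ^ (-1 - 2 * s))), image_Ioi, diffSymbol]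
  rw [rescale, ← lintegral_const_mul' _ _ ENNReal.ofReal_ne_top, diffSymbol]
  refine setLIntegral_congr_fun measurableSet_Ioi fun t ht => ?_
  have weight_eq : t ^ (-1 - 2 * s) = x ^ (2 * s) * (x * (x * t) ^ (-1 - 2 * s)) := by
    rw [Real.mul_rpow hx.le (Set.mem_Ioi.1 ht).le, ← mul_assoc, ← mul_assoc,
      ← Real.rpow_add_one hx.ne', ← Real.rpow_add hx]
    ring_nf
    simp
  simp only [mul_one, mul_comm x t, abs_of_pos hx] at weight_eq ⊢
  rw [weight_eq, ENNReal.ofReal_mul (by positivity), ENNReal.ofReal_mul hx.le]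
  ring

theorem diffSymbol_eq {n : ℕ} {s : ℝ} (hs : 0 < s) (hn : s < n) (x : ℝ) :
    diffSymbol n s x = ENNReal.ofReal (|x| ^ (2 * s)) * diffSymbol n s 1 := by
  rw [← diffSymbol_abs]
  rcases (abs_nonneg x).eq_or_lt with hx | hx
  · have n_ne_zero : n ≠ 0 := by
      rintro rfl
      exact (hs.trans hn).ne' Nat.cast_zero
    simp [← hx, hs.ne', diffSymbol, n_ne_zero]
  · exact diffSymbol_of_pos n s hx

theorem setLIntegral_Ioc_enorm_fourierChar_sub_one_lt_top {n : ℕ} {s : ℝ} (hn : s < n) :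
    ∫⁻ t in Set.Ioc (0 : ℝ) 1, ‖(Real.fourierChar t : ℂ) - 1‖ₑ ^ (2 * n) *
      ENNReal.ofReal (t ^ (-1 - 2 * s)) < ∞ := by
  have rpow_integrable : IntervalIntegrable (fun t : ℝ => t ^ (2 * n - 1 - 2 * s : ℝ)) volume 0 1 :=
    intervalIntegral.intervalIntegrable_rpow' (by linarith)
  rw [intervalIntegrable_iff_integrableOn_Ioc_of_le zero_le_one] at rpow_integrable
  refine (setLIntegral_mono' measurableSet_Ioc fun t ht => ?_).trans_lt
    (rpow_integrable.const_mul ((2 * Real.pi) ^ (2 * n))).lintegral_lt_top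
  have sin_le : |Real.sin (Real.pi * t)| ≤ Real.pi * t := by
    simpa [abs_mul, abs_of_pos, Real.pi_pos, ht.1] using Real.abs_sin_le_abs (x := Real.pi * t)
  rw [← ofReal_norm, ← ENNReal.ofReal_pow (norm_nonneg _), ← ENNReal.ofReal_mul (by positivity),
    norm_fourierChar_sub_one]
  refine ENNReal.ofReal_le_ofReal ?_
  calc (2 * |Real.sin (Real.pi * t)|) ^ (2 * n) * t ^ (-1 - 2 * s)
      ≤ (2 * (Real.pi * t)) ^ (2 * n) * t ^ (-1 - 2 * s) := by
        have := ht.1.le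
        gcongr
    _ = (2 * Real.pi) ^ (2 * n) * t ^ (2 * n - 1 - 2 * s : ℝ) := by
        rw [← mul_assoc, mul_pow, mul_assoc, ← Real.rpow_natCast t, ← Real.rpow_add ht.1]
        congr 2
        push_cast
        ring

theorem setLIntegral_Ioi_enorm_fourierChar_sub_one_lt_top (n : ℕ) {s : ℝ} (hs : 0 < s) :
    ∫⁻ t in Set.Ioi (1 : ℝ), ‖(Real.fourierChar t : ℂ) - 1‖ₑ ^ (2 * n) *
      ENNReal.ofReal (t ^ (-1 - 2 * s)) < ∞ := by
  have rpow_integrable : IntegrableOn (fun t : ℝ => t ^ (-1 - 2 * s)) (Set.Ioi 1) :=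
    integrableOn_Ioi_rpow_of_lt (by linarith) zero_lt_one
  refine (setLIntegral_mono' measurableSet_Ioi fun t ht => ?_).trans_lt
    (rpow_integrable.const_mul (2 ^ (2 * n))).lintegral_lt_top
  rw [← ofReal_norm, ← ENNReal.ofReal_pow (norm_nonneg _), ← ENNReal.ofReal_mul (by positivity),
    norm_fourierChar_sub_one]
  have := zero_lt_one.trans (Set.mem_Ioi.1 ht)
  gcongr
  simpa using Real.abs_sin_le_one (Real.pi * t)

theorem diffSymbol_one_lt_top {n : ℕ} {s : ℝ} (hs : 0 < s) (hn : s < n) :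
    diffSymbol n s 1 < ∞ := by
  rw [diffSymbol, ← Set.Ioc_union_Ioi_eq_Ioi zero_le_one]
  simp only [mul_one]
  exact (lintegral_union_le _ _ _).trans_lt (ENNReal.add_lt_top.2
    ⟨setLIntegral_Ioc_enorm_fourierChar_sub_one_lt_top hn,
      setLIntegral_Ioi_enorm_fourierChar_sub_one_lt_top n hs⟩)

theorem diffSymbol_one_pos (n : ℕ) (s : ℝ) : 0 < diffSymbol n s 1 := by
  have := measurable_enorm_fourierChar_sub_one
  simp only [diffSymbol, mul_one]
  rw [setLIntegral_pos_iff (by fun_prop)]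
  refine lt_of_lt_of_le (b := volume (Set.Ioo (0 : ℝ) 1)) (by simp) (measure_mono fun t ht => ?_)
  have sin_pos : 0 < Real.sin (Real.pi * t) :=
    Real.sin_pos_of_pos_of_lt_pi (mul_pos Real.pi_pos ht.1)
      (mul_lt_of_lt_one_right Real.pi_pos ht.2)
  have fourierChar_ne : (Real.fourierChar t : ℂ) - 1 ≠ 0 := by
    rw [← norm_ne_zero_iff, norm_fourierChar_sub_one]
    positivity
  exact ⟨mul_ne_zero (pow_ne_zero _ (enorm_ne_zero.2 fourierChar_ne))
    (ENNReal.ofReal_pos.2 (Real.rpow_pos_of_pos ht.1 _)).ne', ht.1⟩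

end DifferenceSymbol

section Gagliardo

variable {V F : Type*} [NormedAddCommGroup V] [InnerProductSpace ℝ V] [FiniteDimensional ℝ V]
  [MeasurableSpace V] [BorelSpace V] [NormedAddCommGroup F]

/-- The integral `∫₀^∞ ‖Δ_{te}^n f‖²_{L²} t^{-1-2s} dt`, the square of the Gagliardo seminorm of
order `s` of `f` in the direction `e`, formed with `n`-th differences so that it is meaningful
for every `s < n`. -/
noncomputable def gagliardoSq (n : ℕ) (s : ℝ) (e : V) (f : V → F) : ℝ≥0∞ :=
  ∫⁻ t in Set.Ioi (0 : ℝ), eLpNorm (Δ_[t • e] ^[n] f) 2 volume ^ 2 *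
    ENNReal.ofReal (t ^ (-1 - 2 * s))

theorem gagliardoSq_le_of_eLpNorm_fwdDiff_iter_le {n m : ℕ} {f g : V → F} {C : ℝ≥0∞} (hC : C ≠ ∞)
    (h : ∀ v, eLpNorm (Δ_[v] ^[n] f) 2 volume ≤ C * eLpNorm (Δ_[v] ^[m] g) 2 volume)
    (s : ℝ) (e : V) : gagliardoSq n s e f ≤ C ^ 2 * gagliardoSq m s e g := by
  rw [gagliardoSq, gagliardoSq, ← lintegral_const_mul' _ _ (ENNReal.pow_ne_top hC)]
  refine lintegral_mono fun t => ?_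
  rw [← mul_assoc, ← mul_pow]
  gcongr
  exact h _

variable [InnerProductSpace ℂ F] [CompleteSpace F]

theorem gagliardoSq_eq_lintegral_fourier {n : ℕ} {s : ℝ} (hs : 0 < s) (hn : s < n) (e : V)
    (f : Lp F 2 (volume : Measure V)) :
    gagliardoSq n s e f = (∫⁻ ξ, ENNReal.ofReal (|inner ℝ e ξ| ^ (2 * s)) *
      ‖(𝓕 f : Lp F 2 (volume : Measure V)) ξ‖ₑ ^ 2) * diffSymbol n s 1 := by
  set φ : V → F := ⇑(𝓕 f : Lp F 2 (volume : Measure V)) with hφ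
  have φ_aemeasurable : AEMeasurable (fun ξ => ‖φ ξ‖ₑ ^ 2) volume :=
    (Lp.memLp _).1.enorm.pow_const 2
  have symbol_measurable : Measurable fun q : ℝ × V =>
      ‖(Real.fourierChar (q.1 * inner ℝ e q.2) : ℂ) - 1‖ₑ :=
    measurable_enorm_fourierChar_sub_one.comp (by fun_prop)
  calc gagliardoSq n s e f
      = ∫⁻ t in Set.Ioi (0 : ℝ), ∫⁻ ξ, ‖(Real.fourierChar (t * inner ℝ e ξ) : ℂ) - 1‖ₑ ^ (2 * n) *
          ‖φ ξ‖ₑ ^ 2 * ENNReal.ofReal (t ^ (-1 - 2 * s)) := by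
        refine lintegral_congr fun t => ?_
        rw [eLpNorm_fwdDiff_iter_sq, lintegral_mul_const' _ _ ENNReal.ofReal_ne_top]
        simp only [real_inner_smul_left, hφ]
    _ = ∫⁻ ξ, ∫⁻ t in Set.Ioi (0 : ℝ), ‖(Real.fourierChar (t * inner ℝ e ξ) : ℂ) - 1‖ₑ ^ (2 * n) *
          ‖φ ξ‖ₑ ^ 2 * ENNReal.ofReal (t ^ (-1 - 2 * s)) :=
        lintegral_lintegral_swap (((symbol_measurable.pow_const _).aemeasurable.mul
          φ_aemeasurable.comp_snd).mul (Measurable.aemeasurable (by fun_prop)))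
    _ = ∫⁻ ξ, ENNReal.ofReal (|inner ℝ e ξ| ^ (2 * s)) * ‖φ ξ‖ₑ ^ 2 * diffSymbol n s 1 := by
        refine lintegral_congr fun ξ => ?_
        simp only [mul_right_comm _ (‖φ ξ‖ₑ ^ 2)]
        rw [lintegral_mul_const' _ _ (by finiteness), ← diffSymbol, diffSymbol_eq hs hn]
    _ = _ := lintegral_mul_const'' _
        ((Measurable.aemeasurable (by fun_prop)).mul φ_aemeasurable)

end Gagliardo

section Characterization

theorem rpow_sum_le_card_rpow_mul_sum_rpow {ι : Type*} [Fintype ι] [Nonempty ι] {a : ι → ℝ}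
    (ha : ∀ i, 0 ≤ a i) {s : ℝ} (hs : 0 ≤ s) :
    (∑ i, a i) ^ s ≤ (Fintype.card ι : ℝ) ^ s * ∑ i, a i ^ s := by
  obtain ⟨k, hk⟩ := Finite.exists_max a
  calc (∑ i, a i) ^ s ≤ (Fintype.card ι * a k) ^ s := by
        gcongr
        · exact Finset.sum_nonneg fun i _ => ha i
        · simpa using Finset.sum_le_card_nsmul Finset.univ a (a k) fun i _ => hk i
    _ = (Fintype.card ι : ℝ) ^ s * a k ^ s := Real.mul_rpow (by positivity) (ha k)
    _ ≤ _ := by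
        gcongr
        exact Finset.single_le_sum (f := fun i => a i ^ s) (fun i _ => Real.rpow_nonneg (ha i) s)
          (Finset.mem_univ k)

variable {V F ι : Type*} [NormedAddCommGroup V] [InnerProductSpace ℝ V] [Fintype ι]

theorem one_add_norm_sq_rpow_le (b : OrthonormalBasis ι ℝ V) {s : ℝ} (hs : 0 ≤ s) (ξ : V) :
    (1 + ‖ξ‖ ^ 2) ^ s ≤
      (Fintype.card ι + 1 : ℝ) ^ s * (1 + ∑ i, |inner ℝ (b i) ξ| ^ (2 * s)) := by
  have := rpow_sum_le_card_rpow_mul_sum_rpow (ι := Option ι)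
    (a := fun i => i.elim 1 fun i => |inner ℝ (b i) ξ| ^ 2)
    (by rintro (_ | i) <;> simp [sq_nonneg]) hs
  simpa [Fintype.sum_option, Real.rpow_mul, b.sum_sq_inner_right] using this

theorem abs_inner_rpow_le (b : OrthonormalBasis ι ℝ V) {s : ℝ} (hs : 0 ≤ s) (i : ι) (ξ : V) :
    |inner ℝ (b i) ξ| ^ (2 * s) ≤ (1 + ‖ξ‖ ^ 2) ^ s := by
  rw [Real.rpow_mul (abs_nonneg _), Real.rpow_two]
  have := abs_real_inner_le_norm (b i) ξ
  rw [b.orthonormal.norm_eq_one, one_mul] at this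
  gcongr
  exact (pow_le_pow_left₀ (abs_nonneg _) this 2).trans (le_add_of_nonneg_left zero_le_one)

variable [FiniteDimensional ℝ V] [MeasurableSpace V] [BorelSpace V] [NormedAddCommGroup F]

theorem lintegral_one_add_norm_sq_rpow_lt_top_iff (b : OrthonormalBasis ι ℝ V) {s : ℝ}
    (hs : 0 ≤ s) {φ : V → F} (hφ : MemLp φ 2 volume) :
    ∫⁻ ξ, ENNReal.ofReal ((1 + ‖ξ‖ ^ 2) ^ s) * ‖φ ξ‖ₑ ^ 2 < ∞ ↔
      ∀ i, ∫⁻ ξ, ENNReal.ofReal (|inner ℝ (b i) ξ| ^ (2 * s)) * ‖φ ξ‖ₑ ^ 2 < ∞ := by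
  refine ⟨fun h i => (lintegral_mono fun ξ => ?_).trans_lt h, fun h => ?_⟩
  · gcongr
    exact abs_inner_rpow_le b hs i ξ
  have φ_aemeasurable : AEMeasurable (fun ξ => ‖φ ξ‖ₑ ^ 2) volume := hφ.1.enorm.pow_const 2
  calc ∫⁻ ξ, ENNReal.ofReal ((1 + ‖ξ‖ ^ 2) ^ s) * ‖φ ξ‖ₑ ^ 2
      ≤ ∫⁻ ξ, ENNReal.ofReal ((Fintype.card ι + 1) ^ s) * (‖φ ξ‖ₑ ^ 2 +
          ∑ i, ENNReal.ofReal (|inner ℝ (b i) ξ| ^ (2 * s)) * ‖φ ξ‖ₑ ^ 2) := by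
        refine lintegral_mono fun ξ => ?_
        refine (mul_le_mul_left (ENNReal.ofReal_le_ofReal (one_add_norm_sq_rpow_le b hs ξ))
          _).trans_eq ?_
        rw [ENNReal.ofReal_mul (by positivity), ENNReal.ofReal_add zero_le_one (by positivity),
          ENNReal.ofReal_one, ENNReal.ofReal_sum_of_nonneg fun i _ => by positivity, mul_assoc,
          add_mul, one_mul, Finset.sum_mul]
    _ = ENNReal.ofReal ((Fintype.card ι + 1) ^ s) * (eLpNorm φ 2 volume ^ 2 +
          ∑ i, ∫⁻ ξ, ENNReal.ofReal (|inner ℝ (b i) ξ| ^ (2 * s)) * ‖φ ξ‖ₑ ^ 2) := by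
        rw [lintegral_const_mul' _ _ ENNReal.ofReal_ne_top, lintegral_add_left' φ_aemeasurable,
          lintegral_enorm_sq_eq, lintegral_finsetSum' _ fun i _ => ?_]
        exact AEMeasurable.mul (Measurable.aemeasurable (by fun_prop)) φ_aemeasurable
    _ < ∞ := ENNReal.mul_lt_top ENNReal.ofReal_lt_top (ENNReal.add_lt_top.2
        ⟨ENNReal.pow_lt_top hφ.2, ENNReal.sum_lt_top.2 fun i _ => h i⟩)

variable [InnerProductSpace ℂ F] [CompleteSpace F]

theorem memSobolev_two_iff_gagliardoSq_lt_top (b : OrthonormalBasis ι ℝ V) {n : ℕ} {s : ℝ}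
    (hs : 0 < s) (hn : s < n) (f : Lp F 2 (volume : Measure V)) :
    MemSobolev s 2 (f : 𝓢'(V, F)) ↔ ∀ i, gagliardoSq n s (b i) f < ∞ := by
  rw [memSobolev_two_iff_lintegral_fourier_lt_top,
    lintegral_one_add_norm_sq_rpow_lt_top_iff b hs.le (Lp.memLp _)]
  refine forall_congr' fun i => ?_
  rw [gagliardoSq_eq_lintegral_fourier hs hn]
  exact ⟨fun h => ENNReal.mul_lt_top h (diffSymbol_one_lt_top hs hn),
    fun h => ENNReal.lt_top_of_mul_ne_top_left h.ne (diffSymbol_one_pos n s).ne'⟩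

end Characterization

section Intersection

variable {α E F G : Type*} [MeasurableSpace α] {μ : Measure α} [NormedAddCommGroup E]
  [NormedAddCommGroup F] [NormedAddCommGroup G] {p q : ℝ≥0∞}

/-- `f ∈ L^p ∩ L^q`. -/
def MemLpInter (f : α → E) (p q : ℝ≥0∞) (μ : Measure α) : Prop := MemLp f p μ ∧ MemLp f q μ

/-- The norm `‖f‖_{L^p} + ‖f‖_{L^q}` of `L^p ∩ L^q`. -/
noncomputable def eLpNormInter (f : α → E) (p q : ℝ≥0∞) (μ : Measure α) : ℝ≥0∞ :=
  eLpNorm f p μ + eLpNorm f q μ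

theorem MemLpInter.eLpNormInter_lt_top {f : α → E} (hf : MemLpInter f p q μ) :
    eLpNormInter f p q μ < ∞ :=
  ENNReal.add_lt_top.2 ⟨hf.1.2, hf.2.2⟩

theorem MemLpInter.add {f g : α → E} (hf : MemLpInter f p q μ) (hg : MemLpInter g p q μ) :
    MemLpInter (f + g) p q μ :=
  ⟨hf.1.add hg.1, hf.2.add hg.2⟩

theorem exists_memLp_top_add_memLp {f : α → E} (hf : MemLp f p μ) (hq : q ≠ 0) (hqp : q ≤ p) :
    ∃ g h : α → E, MemLp g ∞ μ ∧ MemLp h q μ ∧ f =ᵐ[μ] g + h := by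
  rcases eq_or_ne p ∞ with rfl | hp
  · exact ⟨f, 0, hf, MemLp.zero, by simp⟩
  set f' : α → E := hf.1.mk f
  have ae_eq : f =ᵐ[μ] f' := hf.1.ae_eq_mk
  have f'_measurable : StronglyMeasurable f' := hf.1.stronglyMeasurable_mk
  have f'_memLp : MemLp f' p μ := hf.ae_eq ae_eq
  set S : Set α := {x | 1 ≤ ‖f' x‖ₑ}
  have S_measurable : MeasurableSet S := measurableSet_le measurable_const f'_measurable.enorm
  have S_finite : IsFiniteMeasure (μ.restrict S) :=
    isFiniteMeasure_restrict.2
      (f'_memLp.meas_ge_lt_top' (pos_of_ne_zero hq |>.trans_le hqp).ne' hp one_ne_zero).ne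
  refine ⟨Sᶜ.indicator f', S.indicator f', memLp_top_of_bound
    (f'_measurable.indicator S_measurable.compl).aestronglyMeasurable 1 (.of_forall fun x => ?_),
    (memLp_indicator_iff_restrict S_measurable).2 ((f'_memLp.restrict S).mono_exponent hqp), ?_⟩
  · by_cases hx : x ∈ S
    · simp [hx]
    · have := (lt_of_not_ge (show ¬1 ≤ ‖f' x‖ₑ from hx)).le
      rw [Set.indicator_of_mem hx]
      rwa [← ofReal_norm, ENNReal.ofReal_le_one] at this
  · rwa [Set.indicator_compl_add_self]

theorem lintegral_enorm_mul_enorm_le {f : α → E} {g : α → F} (hf : AEStronglyMeasurable f μ)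
    (hg : AEStronglyMeasurable g μ) (p q : ℝ≥0∞) [ENNReal.HolderTriple p q 1] :
    ∫⁻ x, ‖f x‖ₑ * ‖g x‖ₑ ∂μ ≤ eLpNorm f p μ * eLpNorm g q μ := by
  have := eLpNorm_le_eLpNorm_mul_eLpNorm_of_nnnorm (p := p) (q := q) (r := 1) hf hg
    (fun a b => ‖a‖ * ‖b‖) 1 (.of_forall fun x => by simp)
  simpa [eLpNorm_one_eq_lintegral_enorm, enorm_mul] using this

variable {𝕜 : Type*} [NontriviallyNormedField 𝕜] [NormedSpace 𝕜 E] [NormedSpace 𝕜 F]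
  [NormedSpace 𝕜 G]

theorem eLpNormInter_bilin_le (B : E →L[𝕜] F →L[𝕜] G) {f : α → E} {g : α → F}
    (hf : AEStronglyMeasurable f μ) (hg : AEStronglyMeasurable g μ) :
    eLpNormInter (fun x => B (f x) (g x)) 1 2 μ ≤
      ‖B‖ₑ * eLpNormInter f 2 ∞ μ * eLpNorm g 2 μ := by
  rw [eLpNormInter, eLpNormInter, mul_add, add_mul]
  exact add_le_add (eLpNorm_bilin_le B hf hg 2 2) (eLpNorm_bilin_le B hf hg ∞ 2)

end Intersection

/-- Convolution with `W` maps `L¹ ∩ L²` to `L^∞`, with norm at most `K`: the bound is stated for the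
integrals of absolute values, so that it contains the existence of the convolutions. -/
structure ConvBound {d : ℕ} (W : Eucl d → ℂ) (K : ℝ≥0) : Prop where
  aestronglyMeasurable : AEStronglyMeasurable W volume
  lintegral_le : ∀ g : Eucl d → ℝ, AEStronglyMeasurable g volume → ∀ x,
    ∫⁻ y, ‖W y‖ₑ * ‖g (x - y)‖ₑ ≤ K * eLpNormInter g 1 2 volume

theorem MemLpAdd.top_two {d : ℕ} {W : Eucl d → ℂ} {p : ℝ≥0∞} (hW : MemLpAdd W ∞ p) (hp : 2 ≤ p) :
    MemLpAdd W ∞ 2 := by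
  obtain ⟨W₁, W₂, hW₁, hW₂, hW⟩ := hW
  obtain ⟨A, B, hA, hB, hAB⟩ := exists_memLp_top_add_memLp hW₂ two_ne_zero hp
  refine ⟨W₁ + A, B, hW₁.add hA, hB, hW.trans ?_⟩
  rw [add_assoc]
  exact .add .rfl hAB

theorem MemLpAdd.exists_convBound {d : ℕ} {W : Eucl d → ℂ} (hW : MemLpAdd W ∞ 2) :
    ∃ K, ConvBound W K := by
  obtain ⟨W₁, W₂, hW₁, hW₂, hW⟩ := hW
  refine ⟨(eLpNorm W₁ ∞ volume + eLpNorm W₂ 2 volume).toNNReal,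
    (hW₁.1.add hW₂.1).congr hW.symm, fun g hg x => ?_⟩
  have sub_left := Measure.measurePreserving_sub_left volume x
  have g_measurable := hg.comp_measurePreserving sub_left
  calc ∫⁻ y, ‖W y‖ₑ * ‖g (x - y)‖ₑ
      ≤ ∫⁻ y, ‖W₁ y‖ₑ * ‖g (x - y)‖ₑ + ‖W₂ y‖ₑ * ‖g (x - y)‖ₑ := by
        refine lintegral_mono_ae ?_
        filter_upwards [hW] with y hy
        rw [hy, ← add_mul]
        gcongr
        exact enorm_add_le _ _
    _ ≤ eLpNorm W₁ ∞ volume * eLpNorm g 1 volume + eLpNorm W₂ 2 volume * eLpNorm g 2 volume := by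
        rw [lintegral_add_left' (by exact hW₁.1.enorm.mul g_measurable.enorm),
          ← eLpNorm_comp_measurePreserving hg sub_left,
          ← eLpNorm_comp_measurePreserving hg sub_left]
        exact add_le_add (lintegral_enorm_mul_enorm_le hW₁.1 g_measurable ∞ 1)
          (lintegral_enorm_mul_enorm_le hW₂.1 g_measurable 2 2)
    _ ≤ (eLpNorm W₁ ∞ volume + eLpNorm W₂ 2 volume) * eLpNormInter g 1 2 volume := by
        rw [eLpNormInter, add_mul, mul_add, mul_add]
        exact add_le_add le_self_add le_add_self
    _ = _ := by rw [ENNReal.coe_toNNReal (ENNReal.add_lt_top.2 ⟨hW₁.2, hW₂.2⟩).ne]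

theorem enorm_mul_ofReal (z : ℂ) (r : ℝ) : ‖z * r‖ₑ = ‖z‖ₑ * ‖r‖ₑ := by
  rw [enorm_mul, ← ofReal_norm (r : ℂ), Complex.norm_real, ofReal_norm]

section Conv

variable {d : ℕ} {W : Eucl d → ℂ} {g g₁ g₂ : Eucl d → ℝ}

theorem conv_congr_ae (W : Eucl d → ℂ) (hg : g₁ =ᵐ[volume] g₂) : conv W g₁ = conv W g₂ := by
  ext x
  have sub_left := Measure.measurePreserving_sub_left volume x
  refine integral_congr_ae ?_
  filter_upwards [sub_left.quasiMeasurePreserving.ae_eq_comp hg] with y hy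
  simp only [Function.comp_apply] at hy
  simp only [hy]

theorem conv_add (h₁ : ConvExists W g₁) (h₂ : ConvExists W g₂) :
    conv W (g₁ + g₂) = conv W g₁ + conv W g₂ := by
  simpa [conv, Pi.add_def] using h₁.distrib_add h₂

theorem conv_smul (c : ℝ) : conv W (c • g) = c • conv W g := by
  simpa [conv, Pi.smul_def] using
    convolution_smul (L := ContinuousLinearMap.mul ℂ ℂ) (μ := volume) (f := W)
      (g := fun y => (g y : ℂ)) (y := c)

theorem conv_comp_add_right (h x : Eucl d) : conv W (fun y => g (y + h)) x = conv W g (x + h) := by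
  simp only [conv, convolution_def, sub_add_eq_add_sub]

theorem fwdDiff_conv (h : Eucl d) (h₁ : ConvExists W g) (h₂ : ConvExists W (Δ_[h] g)) :
    Δ_[h] (conv W g) = conv W (Δ_[h] g) := by
  have translate : (fun y => g (y + h)) = Δ_[h] g + g := by
    ext y
    simp [fwdDiff]
  ext x
  rw [fwdDiff, ← conv_comp_add_right, translate, conv_add h₂ h₁, Pi.add_apply, add_sub_cancel_right]

end Conv

namespace ConvBound

variable {d : ℕ} {W : Eucl d → ℂ} {K : ℝ≥0} {g : Eucl d → ℝ}

theorem lintegral_enorm_le (hW : ConvBound W K) (hg : AEStronglyMeasurable g volume) (x : Eucl d) :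
    ∫⁻ y, ‖W y * (g (x - y) : ℂ)‖ₑ ≤ K * eLpNormInter g 1 2 volume := by
  simpa only [enorm_mul_ofReal] using hW.lintegral_le g hg x

theorem convExists (hW : ConvBound W K) (hg : MemLpInter g 1 2 volume) : ConvExists W g :=
  fun x => ⟨hW.aestronglyMeasurable.mul (Complex.continuous_ofReal.comp_aestronglyMeasurable
    (hg.1.1.comp_measurePreserving (Measure.measurePreserving_sub_left volume x))),
    (hW.lintegral_enorm_le hg.1.1 x).trans_lt
      (ENNReal.mul_lt_top ENNReal.coe_lt_top hg.eLpNormInter_lt_top)⟩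

theorem enorm_conv_le (hW : ConvBound W K) (hg : AEStronglyMeasurable g volume) (x : Eucl d) :
    ‖conv W g x‖ₑ ≤ K * eLpNormInter g 1 2 volume :=
  (enorm_integral_le_lintegral_enorm _).trans (hW.lintegral_enorm_le hg x)

theorem aestronglyMeasurable_conv (hW : ConvBound W K) (hg : AEStronglyMeasurable g volume) :
    AEStronglyMeasurable (conv W g) volume :=
  (hW.aestronglyMeasurable.convolution_integrand (ContinuousLinearMap.mul ℂ ℂ)
    (Complex.continuous_ofReal.comp_aestronglyMeasurable hg)).integral_prod_right'

theorem eLpNorm_conv_le (hW : ConvBound W K) (hg : AEStronglyMeasurable g volume) :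
    eLpNorm (conv W g) ∞ volume ≤ K * eLpNormInter g 1 2 volume := by
  rw [eLpNorm_exponent_top]
  exact eLpNormEssSup_le_of_ae_enorm_bound (.of_forall (hW.enorm_conv_le hg))

theorem memLp_conv (hW : ConvBound W K) (hg : MemLpInter g 1 2 volume) :
    MemLp (conv W g) ∞ volume :=
  ⟨hW.aestronglyMeasurable_conv hg.1.1, (hW.eLpNorm_conv_le hg.1.1).trans_lt
    (ENNReal.mul_lt_top ENNReal.coe_lt_top hg.eLpNormInter_lt_top)⟩

theorem eLpNorm_conv_mul_le (hW : ConvBound W K) (hg : AEStronglyMeasurable g volume)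
    {v : Eucl d → ℂ} (hv : AEStronglyMeasurable v volume) :
    eLpNorm (fun x => conv W g x * v x) 2 volume ≤
      K * eLpNormInter g 1 2 volume * eLpNorm v 2 volume := by
  refine (eLpNorm_smul_le_mul_eLpNorm (p := ∞) (q := 2) hv
    (hW.aestronglyMeasurable_conv hg)).trans ?_
  gcongr
  exact hW.eLpNorm_conv_le hg

theorem fwdDiff_iter_conv (hW : ConvBound W K) (hg : MemLpInter g 1 2 volume) (h : Eucl d)
    (n : ℕ) : Δ_[h] ^[n] (conv W g) = conv W (Δ_[h] ^[n] g) := by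
  induction n with
  | zero => rfl
  | succ n ih =>
    have fwdDiff_mem (k : ℕ) : MemLpInter (Δ_[h] ^[k] g) 1 2 volume :=
      ⟨memLp_fwdDiff_iter hg.1 h k, memLp_fwdDiff_iter hg.2 h k⟩
    have convExists_succ := hW.convExists (fwdDiff_mem (n + 1))
    rw [Function.iterate_succ_apply'] at convExists_succ
    rw [Function.iterate_succ_apply', Function.iterate_succ_apply', ih,
      fwdDiff_conv h (hW.convExists (fwdDiff_mem n)) convExists_succ]

theorem eLpNorm_fwdDiff_iter_conv_le (hW : ConvBound W K) (hg : MemLpInter g 1 2 volume)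
    (h : Eucl d) (n : ℕ) : eLpNorm (Δ_[h] ^[n] (conv W g)) ∞ volume ≤
      K * eLpNormInter (Δ_[h] ^[n] g) 1 2 volume := by
  rw [hW.fwdDiff_iter_conv hg]
  exact hW.eLpNorm_conv_le (aestronglyMeasurable_fwdDiff_iter hg.1.1 h n)

end ConvBound

section ReConjMul

variable {d : ℕ} {u u' v v' w : Eucl d → ℂ}

theorem reConjMul_eq_innerSL (u v : Eucl d → ℂ) :
    reConjMul u v = fun x => innerSL ℝ (u x) (v x) := by
  ext x
  rw [innerSL_apply_apply, Complex.inner, reConjMul, mul_comm]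

theorem absSq_eq_reConjMul (u : Eucl d → ℂ) : absSq u = reConjMul u u := by
  ext x
  simp only [reConjMul_eq_innerSL, innerSL_apply_apply, real_inner_self_eq_norm_sq, absSq]

theorem reConjMul_add_right (u v w : Eucl d → ℂ) :
    reConjMul u (v + w) = reConjMul u v + reConjMul u w := by
  ext x
  simp only [reConjMul_eq_innerSL, Pi.add_apply, map_add]

theorem reConjMul_smul_right (c : ℝ) (u v : Eucl d → ℂ) :
    reConjMul u (c • v) = c • reConjMul u v := by
  ext x
  simp only [reConjMul_eq_innerSL, Pi.smul_apply, map_smul]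

theorem absSq_add (u w : Eucl d → ℂ) :
    absSq (u + w) = absSq u + (2 : ℝ) • reConjMul u w + absSq w := by
  ext x
  simpa only [absSq, reConjMul_eq_innerSL, innerSL_apply_apply, Pi.add_apply, Pi.smul_apply,
    smul_eq_mul] using norm_add_sq_real (u x) (w x)

theorem reConjMul_congr_ae_right (u : Eucl d → ℂ) (hv : v =ᵐ[volume] v') :
    reConjMul u v =ᵐ[volume] reConjMul u v' := by
  filter_upwards [hv] with x hx
  rw [reConjMul, hx, reConjMul]

theorem absSq_congr_ae (hu : u =ᵐ[volume] u') : absSq u =ᵐ[volume] absSq u' := by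
  filter_upwards [hu] with x hx
  rw [absSq, hx, absSq]

theorem enorm_innerSL_real_complex : ‖(innerSL ℝ : ℂ →L[ℝ] ℂ →L[ℝ] ℝ)‖ₑ = 1 := by
  rw [← ofReal_norm, InnerProductSpace.innerSL_norm ℝ, ENNReal.ofReal_one]

theorem enorm_mul_real_complex : ‖ContinuousLinearMap.mul ℝ ℂ‖ₑ = 1 := by
  rw [← ofReal_norm, ContinuousLinearMap.opNorm_mul, ENNReal.ofReal_one]

theorem aestronglyMeasurable_reConjMul (hu : AEStronglyMeasurable u volume)
    (hv : AEStronglyMeasurable v volume) : AEStronglyMeasurable (reConjMul u v) volume :=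
  Complex.continuous_re.comp_aestronglyMeasurable
    ((Complex.continuous_conj.comp_aestronglyMeasurable hu).mul hv)

theorem eLpNormInter_reConjMul_le (hu : AEStronglyMeasurable u volume)
    (hv : AEStronglyMeasurable v volume) :
    eLpNormInter (reConjMul u v) 1 2 volume ≤ eLpNormInter u 2 ∞ volume * eLpNorm v 2 volume := by
  have bilin_le := eLpNormInter_bilin_le (innerSL ℝ : ℂ →L[ℝ] ℂ →L[ℝ] ℝ) hu hv
  rwa [enorm_innerSL_real_complex, one_mul, ← reConjMul_eq_innerSL] at bilin_le

theorem MemLpInter.reConjMul (hu : MemLpInter u 2 ∞ volume) (hv : MemLp v 2 volume) :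
    MemLpInter (reConjMul u v) 1 2 volume := by
  have measurable := aestronglyMeasurable_reConjMul hu.1.1 hv.1
  have norm_lt_top := (eLpNormInter_reConjMul_le hu.1.1 hv.1).trans_lt
    (ENNReal.mul_lt_top hu.eLpNormInter_lt_top hv.2)
  exact ⟨⟨measurable, le_self_add.trans_lt norm_lt_top⟩,
    ⟨measurable, le_add_self.trans_lt norm_lt_top⟩⟩

theorem MemLpInter.absSq (hu : MemLpInter u 2 ∞ volume) : MemLpInter (absSq u) 1 2 volume := by
  rw [absSq_eq_reConjMul]
  exact hu.reConjMul hu.1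

theorem eLpNormInter_absSq_le (hu : AEStronglyMeasurable u volume) :
    eLpNormInter (absSq u) 1 2 volume ≤ eLpNormInter u 2 ∞ volume ^ 2 := by
  rw [absSq_eq_reConjMul, sq]
  refine (eLpNormInter_reConjMul_le hu hu).trans ?_
  gcongr
  exact le_self_add

theorem eLpNormInter_fwdDiff_iter_absSq_le (hu : AEStronglyMeasurable u volume) (h : Eucl d)
    (m : ℕ) : eLpNormInter (Δ_[h] ^[m + m] (absSq u)) 1 2 volume ≤
      2 * 3 ^ (m + m) * eLpNormInter u 2 ∞ volume * eLpNorm (Δ_[h] ^[m] u) 2 volume := by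
  have norm_one := eLpNorm_fwdDiff_iter_add_bilin_le (innerSL ℝ : ℂ →L[ℝ] ℂ →L[ℝ] ℝ) hu hu
    2 2 2 2 (r := 1) le_rfl h m m
  have norm_two := eLpNorm_fwdDiff_iter_add_bilin_le (innerSL ℝ : ℂ →L[ℝ] ℂ →L[ℝ] ℝ) hu hu
    2 ∞ ∞ 2 (r := 2) one_le_two h m m
  rw [absSq_eq_reConjMul, reConjMul_eq_innerSL, eLpNormInter, eLpNormInter]
  refine (add_le_add norm_one norm_two).trans_eq ?_
  rw [enorm_innerSL_real_complex]
  ring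

end ReConjMul

section Hartree

variable {d : ℕ} {W u v v' w : Eucl d → ℂ} {K : ℝ≥0}

theorem hartree_congr_ae (W : Eucl d → ℂ) (hv : v =ᵐ[volume] v') :
    hartree W v =ᵐ[volume] hartree W v' := by
  filter_upwards [hv] with x hx
  rw [hartree, hartree, conv_congr_ae W (absSq_congr_ae hv), hx]

theorem hartreeDeriv_congr_ae_right (W u : Eucl d → ℂ) (hv : v =ᵐ[volume] v') :
    hartreeDeriv W u v =ᵐ[volume] hartreeDeriv W u v' := by
  filter_upwards [hv] with x hx
  rw [hartreeDeriv, hartreeDeriv, conv_congr_ae W (reConjMul_congr_ae_right u hv), hx]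

theorem hartreeDeriv_smul (W u : Eucl d → ℂ) (c : ℝ) (v : Eucl d → ℂ) :
    hartreeDeriv W u (c • v) = c • hartreeDeriv W u v := by
  ext x
  simp only [hartreeDeriv, reConjMul_smul_right, conv_smul, Pi.smul_apply, Complex.real_smul]
  ring

theorem hartreeDeriv_eq_add_smul (W u v : Eucl d → ℂ) :
    hartreeDeriv W u v = (fun x => conv W (absSq u) x * v x) +
      (2 : ℝ) • fun x => conv W (reConjMul u v) x * u x := by
  ext x
  simp [hartreeDeriv, mul_assoc]

namespace ConvBound

theorem hartreeDeriv_add (hW : ConvBound W K) (hu : MemLpInter u 2 ∞ volume)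
    (hv : MemLp v 2 volume) (hw : MemLp w 2 volume) :
    hartreeDeriv W u (v + w) = hartreeDeriv W u v + hartreeDeriv W u w := by
  ext x
  simp only [hartreeDeriv, reConjMul_add_right, Pi.add_apply,
    conv_add (hW.convExists (hu.reConjMul hv)) (hW.convExists (hu.reConjMul hw))]
  ring

theorem conv_absSq_add (hW : ConvBound W K) (hu : MemLpInter u 2 ∞ volume)
    (hw : MemLpInter w 2 ∞ volume) :
    conv W (absSq (u + w)) = conv W (absSq u) + (2 : ℝ) • conv W (reConjMul u w) +
      conv W (absSq w) := by
  have cross_mem : MemLpInter ((2 : ℝ) • reConjMul u w) 1 2 volume :=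
    ⟨(hu.reConjMul hw.1).1.const_smul 2, (hu.reConjMul hw.1).2.const_smul 2⟩
  rw [absSq_add, conv_add (hW.convExists (hu.absSq.add cross_mem)) (hW.convExists hw.absSq),
    conv_add (hW.convExists hu.absSq) (hW.convExists cross_mem), conv_smul]

theorem hartree_add_sub_sub_hartreeDeriv (hW : ConvBound W K) (hu : MemLpInter u 2 ∞ volume)
    (hw : MemLpInter w 2 ∞ volume) :
    hartree W (u + w) - hartree W u - hartreeDeriv W u w =
      (2 : ℝ) • (fun x => conv W (reConjMul u w) x * w x) +
        fun x => conv W (absSq w) x * (u + w) x := by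
  ext x
  simp only [hartree, hartreeDeriv, hW.conv_absSq_add hu hw, Pi.sub_apply, Pi.add_apply,
    Pi.smul_apply, Complex.real_smul]
  push_cast
  ring

theorem memLp_conv_mul (hW : ConvBound W K) {g : Eucl d → ℝ} (hg : MemLpInter g 1 2 volume)
    {p : ℝ≥0∞} (hv : MemLp v p volume) : MemLp (fun x => conv W g x * v x) p volume :=
  hv.mul (hW.memLp_conv hg)

theorem memLp_hartree (hW : ConvBound W K) (hu : MemLpInter u 2 ∞ volume) :
    MemLp (hartree W u) 2 volume :=
  hu.1.mul (hW.memLp_conv hu.absSq)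

theorem memLp_hartreeDeriv (hW : ConvBound W K) (hu : MemLpInter u 2 ∞ volume)
    (hv : MemLp v 2 volume) : MemLp (hartreeDeriv W u v) 2 volume := by
  rw [hartreeDeriv_eq_add_smul]
  exact (hW.memLp_conv_mul hu.absSq hv).add
    ((hW.memLp_conv_mul (hu.reConjMul hv) hu.1).const_smul 2)

theorem aestronglyMeasurable_conv_reConjMul_mul (hW : ConvBound W K)
    (hu : AEStronglyMeasurable u volume) (hv : AEStronglyMeasurable v volume)
    (hw : AEStronglyMeasurable w volume) :
    AEStronglyMeasurable (fun x => conv W (reConjMul u v) x * w x) volume :=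
  (hW.aestronglyMeasurable_conv (aestronglyMeasurable_reConjMul hu hv)).mul hw

theorem eLpNorm_conv_reConjMul_mul_le (hW : ConvBound W K) (hu : AEStronglyMeasurable u volume)
    (hv : AEStronglyMeasurable v volume) (hw : AEStronglyMeasurable w volume) :
    eLpNorm (fun x => conv W (reConjMul u v) x * w x) 2 volume ≤
      K * (eLpNormInter u 2 ∞ volume * eLpNorm v 2 volume) * eLpNorm w 2 volume := by
  refine (hW.eLpNorm_conv_mul_le (aestronglyMeasurable_reConjMul hu hv) hw).trans ?_
  gcongr
  exact eLpNormInter_reConjMul_le hu hv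

theorem eLpNorm_hartreeDeriv_le (hW : ConvBound W K) (hu : AEStronglyMeasurable u volume)
    (hv : AEStronglyMeasurable v volume) :
    eLpNorm (hartreeDeriv W u v) 2 volume ≤
      3 * K * eLpNormInter u 2 ∞ volume ^ 2 * eLpNorm v 2 volume := by
  have eLpNorm_le : eLpNorm u 2 volume ≤ eLpNormInter u 2 ∞ volume := le_self_add
  rw [hartreeDeriv_eq_add_smul, absSq_eq_reConjMul]
  refine (eLpNorm_add_le (hW.aestronglyMeasurable_conv_reConjMul_mul hu hu hv)
    ((hW.aestronglyMeasurable_conv_reConjMul_mul hu hv hu).const_smul (2 : ℝ)) one_le_two).trans ?_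
  rw [eLpNorm_const_smul, show ‖(2 : ℝ)‖ₑ = 2 by simp [← ofReal_norm]]
  set N := eLpNormInter u 2 ∞ volume
  calc _ ≤ K * (N * N) * eLpNorm v 2 volume + 2 * (K * (N * eLpNorm v 2 volume) * N) := by
        gcongr
        · exact (hW.eLpNorm_conv_reConjMul_mul_le hu hu hv).trans (by gcongr)
        · exact (hW.eLpNorm_conv_reConjMul_mul_le hu hv hu).trans (by gcongr)
    _ = _ := by ring

theorem eLpNorm_hartree_add_sub_sub_hartreeDeriv_le (hW : ConvBound W K)
    (hu : MemLpInter u 2 ∞ volume) (hw : MemLpInter w 2 ∞ volume) :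
    eLpNorm (hartree W (u + w) - hartree W u - hartreeDeriv W u w) 2 volume ≤
      K * eLpNormInter w 2 ∞ volume *
        (3 * eLpNormInter u 2 ∞ volume + eLpNormInter w 2 ∞ volume) * eLpNorm w 2 volume := by
  have eLpNorm_u_le : eLpNorm u 2 volume ≤ eLpNormInter u 2 ∞ volume := le_self_add
  have eLpNorm_w_le : eLpNorm w 2 volume ≤ eLpNormInter w 2 ∞ volume := le_self_add
  have eLpNorm_add_w_le : eLpNorm (u + w) 2 volume ≤ _ :=
    eLpNorm_add_le hu.1.1 hw.1.1 one_le_two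
  rw [hW.hartree_add_sub_sub_hartreeDeriv hu hw, absSq_eq_reConjMul]
  refine (eLpNorm_add_le
    ((hW.aestronglyMeasurable_conv_reConjMul_mul hu.1.1 hw.1.1 hw.1.1).const_smul (2 : ℝ))
    (hW.aestronglyMeasurable_conv_reConjMul_mul hw.1.1 hw.1.1 (hu.1.1.add hw.1.1))
    one_le_two).trans ?_
  rw [eLpNorm_const_smul, show ‖(2 : ℝ)‖ₑ = 2 by simp [← ofReal_norm]]
  set N := eLpNormInter u 2 ∞ volume
  set M := eLpNormInter w 2 ∞ volume
  calc _ ≤ 2 * (K * (N * eLpNorm w 2 volume) * M) + K * (M * eLpNorm w 2 volume) * (N + M) := by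
        gcongr
        · exact (hW.eLpNorm_conv_reConjMul_mul_le hu.1.1 hw.1.1 hw.1.1).trans (by gcongr)
        · exact (hW.eLpNorm_conv_reConjMul_mul_le hw.1.1 hw.1.1 (hu.1.1.add hw.1.1)).trans
            (by gcongr; exact eLpNorm_add_w_le.trans (by gcongr))
    _ = _ := by ring

/-- Of the `3m` differences of the triple product, `m` fall on one and the same factor. -/
theorem eLpNorm_fwdDiff_iter_hartree_le (hW : ConvBound W K) (hu : MemLpInter u 2 ∞ volume)
    (h : Eucl d) (m : ℕ) :
    eLpNorm (Δ_[h] ^[m + m + m] (hartree W u)) 2 volume ≤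
      3 ^ (m + m + m) * K * eLpNormInter u 2 ∞ volume ^ 2 * (2 * 3 ^ (m + m) + 1) *
        eLpNorm (Δ_[h] ^[m] u) 2 volume := by
  have eLpNorm_le : eLpNorm u 2 volume ≤ eLpNormInter u 2 ∞ volume := le_self_add
  have katoPonce := eLpNorm_fwdDiff_iter_add_bilin_le (ContinuousLinearMap.mul ℝ ℂ)
    (hW.memLp_conv hu.absSq).1 hu.1.1 ∞ 2 ∞ 2 (r := 2) one_le_two h (m + m) m
  rw [enorm_mul_real_complex, mul_one] at katoPonce
  refine katoPonce.trans ?_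
  set N := eLpNormInter u 2 ∞ volume
  set D := eLpNorm (Δ_[h] ^[m] u) 2 volume
  calc _ ≤ 3 ^ (m + m + m) * (K * (2 * 3 ^ (m + m) * N * D) * N + K * N ^ 2 * D) := by
        gcongr
        · exact (hW.eLpNorm_fwdDiff_iter_conv_le hu.absSq h _).trans
            (by gcongr; exact eLpNormInter_fwdDiff_iter_absSq_le hu.1.1 h m)
        · exact (hW.eLpNorm_conv_le hu.absSq.1.1).trans
            (by gcongr; exact eLpNormInter_absSq_le hu.1.1)
    _ = _ := by ring

end ConvBound

end Hartree

section Operators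

variable {d : ℕ} {W u : Eucl d → ℂ} {K : ℝ≥0}

/-- The operator `B'(u)` on `L²`, for `u ∈ L² ∩ L^∞`. -/
noncomputable def hartreeDerivCLM (hW : ConvBound W K) (hu : MemLpInter u 2 ∞ volume) :
    L2 d →L[ℝ] L2 d :=
  LinearMap.mkContinuous
    { toFun := fun v => (hW.memLp_hartreeDeriv hu (Lp.memLp v)).toLp
      map_add' := fun v w => by
        rw [← MemLp.toLp_add, MemLp.toLp_eq_toLp_iff,
          ← hW.hartreeDeriv_add hu (Lp.memLp v) (Lp.memLp w)]
        exact hartreeDeriv_congr_ae_right W u (Lp.coeFn_add v w)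
      map_smul' := fun c v => by
        rw [RingHom.id_apply, ← MemLp.toLp_const_smul, MemLp.toLp_eq_toLp_iff,
          ← hartreeDeriv_smul]
        exact hartreeDeriv_congr_ae_right W u (Lp.coeFn_smul c v) }
    (3 * K * eLpNormInter u 2 ∞ volume ^ 2).toReal fun v => by
      have factor_ne_top : 3 * (K : ℝ≥0∞) * eLpNormInter u 2 ∞ volume ^ 2 ≠ ∞ := by
        have := hu.eLpNormInter_lt_top.ne
        finiteness
      rw [LinearMap.coe_mk, AddHom.coe_mk, Lp.norm_toLp, Lp.norm_def, ← ENNReal.toReal_mul]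
      exact ENNReal.toReal_mono (ENNReal.mul_ne_top factor_ne_top (Lp.memLp v).2.ne)
        (hW.eLpNorm_hartreeDeriv_le hu.1.1 (Lp.memLp v).1)

theorem coeFn_hartreeDerivCLM (hW : ConvBound W K) (hu : MemLpInter u 2 ∞ volume) (v : L2 d) :
    hartreeDerivCLM hW hu v =ᵐ[volume] hartreeDeriv W u v :=
  (hW.memLp_hartreeDeriv hu (Lp.memLp v)).coeFn_toLp

theorem enorm_hartreeDerivCLM_le (hW : ConvBound W K) (hu : MemLpInter u 2 ∞ volume) :
    ‖hartreeDerivCLM hW hu‖ₑ ≤ 3 * K * eLpNormInter u 2 ∞ volume ^ 2 := by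
  rw [← ofReal_norm]
  exact (ENNReal.ofReal_le_ofReal (LinearMap.mkContinuous_norm_le _ ENNReal.toReal_nonneg _)).trans
    ENNReal.ofReal_toReal_le

end Operators

namespace HSob

variable {d : ℕ} {s : ℝ} {W : Eucl d → ℂ} {K : ℝ≥0}

theorem memLpInter (hs : (d : ℝ) / 2 < s) (u : HSob d s) : MemLpInter (toL2 u) 2 ∞ volume := by
  obtain ⟨C, hC⟩ := exists_eLpNorm_top_le hs
  exact ⟨Lp.memLp _, (Lp.memLp _).1,
    (hC u).trans_lt (ENNReal.mul_lt_top ENNReal.coe_lt_top enorm_lt_top)⟩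

theorem exists_eLpNormInter_le (hs : (d : ℝ) / 2 < s) :
    ∃ A : ℝ≥0, ∀ u : HSob d s, eLpNormInter (toL2 u) 2 ∞ volume ≤ A * ‖u‖ₑ := by
  obtain ⟨C, hC⟩ := exists_eLpNorm_top_le hs
  have s_nonneg : 0 ≤ s := (by positivity : (0 : ℝ) ≤ d / 2).trans hs.le
  refine ⟨1 + C, fun u => ?_⟩
  rw [eLpNormInter, ENNReal.coe_add, ENNReal.coe_one, add_mul, one_mul, ← Lp.enorm_def]
  exact add_le_add (enorm_le_iff_norm_le.2 (norm_toL2_le s_nonneg u)) (hC u)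

theorem memSobolev_hartree (hs : (d : ℝ) / 2 < s) (hW : ConvBound W K) (u : HSob d s) :
    MemSobolev s 2 ((hW.memLp_hartree (u.memLpInter hs)).toLp : 𝓢'(Eucl d, ℂ)) := by
  have s_pos : 0 < s := (by positivity : (0 : ℝ) ≤ d / 2).trans_lt hs
  have hu := u.memLpInter hs
  obtain ⟨m, hm⟩ := exists_nat_gt s
  have order_gt : s < (m + m + m : ℕ) := by
    push_cast
    linarith
  let b := EuclideanSpace.basisFun (Fin d) ℝ
  have norm_ne_top := hu.eLpNormInter_lt_top.ne
  rw [memSobolev_two_iff_gagliardoSq_lt_top b s_pos order_gt]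
  intro i
  have u_lt_top := (memSobolev_two_iff_gagliardoSq_lt_top b s_pos hm _).1 u.memSobolev i
  refine (gagliardoSq_le_of_eLpNorm_fwdDiff_iter_le (C := 3 ^ (m + m + m) * K *
    eLpNormInter (toL2 u) 2 ∞ volume ^ 2 * (2 * 3 ^ (m + m) + 1)) (by finiteness)
    (fun h => ?_) s (b i)).trans_lt (ENNReal.mul_lt_top (by finiteness) u_lt_top)
  rw [eLpNorm_congr_ae (fwdDiff_iter_congr_ae (hW.memLp_hartree hu).coeFn_toLp h _)]
  exact hW.eLpNorm_fwdDiff_iter_hartree_le hu h m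

/-- The Hartree nonlinearity `B` as a map of `H^s` to itself. -/
noncomputable def hartreeMap (hs : (d : ℝ) / 2 < s) (hW : ConvBound W K) (u : HSob d s) :
    HSob d s :=
  ⟨(hW.memLp_hartree (u.memLpInter hs)).toLp, memSobolev_hartree hs hW u⟩

theorem coeFn_hartreeMap (hs : (d : ℝ) / 2 < s) (hW : ConvBound W K) (u : HSob d s) :
    (toL2 (hartreeMap hs hW u) : Eucl d → ℂ) =ᵐ[volume] hartree W (toL2 u) :=
  (hW.memLp_hartree (u.memLpInter hs)).coeFn_toLp

theorem enorm_hartreeMap_add_sub_sub_le (hs : (d : ℝ) / 2 < s) (hW : ConvBound W K)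
    (u w : HSob d s) :
    ‖toL2 (hartreeMap hs hW (u + w)) - toL2 (hartreeMap hs hW u) -
        hartreeDerivCLM hW (u.memLpInter hs) (toL2 w)‖ₑ ≤
      K * eLpNormInter (toL2 w) 2 ∞ volume *
        (3 * eLpNormInter (toL2 u) 2 ∞ volume + eLpNormInter (toL2 w) 2 ∞ volume) *
          ‖toL2 w‖ₑ := by
  have hartree_add : (toL2 (hartreeMap hs hW (u + w)) : Eucl d → ℂ) =ᵐ[volume]
      hartree W (toL2 u + toL2 w) :=
    (coeFn_hartreeMap hs hW (u + w)).trans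
      (hartree_congr_ae W (by rw [map_add]; exact Lp.coeFn_add _ _))
  have remainder_ae_eq := (Lp.coeFn_sub _ _).trans (((Lp.coeFn_sub _ _).trans
    (hartree_add.sub (coeFn_hartreeMap hs hW u))).sub
      (coeFn_hartreeDerivCLM hW (u.memLpInter hs) (toL2 w)))
  rw [Lp.enorm_def, Lp.enorm_def, eLpNorm_congr_ae remainder_ae_eq]
  exact hW.eLpNorm_hartree_add_sub_sub_hartreeDeriv_le (u.memLpInter hs) (w.memLpInter hs)

end HSob

theorem DerivCondition.of_norm_le {H₁ H₀ : Type*} [NormedAddCommGroup H₁] [NormedSpace ℂ H₁]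
    [NormedAddCommGroup H₀] [NormedSpace ℂ H₀] [NormedSpace ℝ H₀] [IsScalarTower ℝ ℂ H₀]
    {ι : H₁ →ₗ[ℂ] H₀} {B : H₁ → H₁} {B' : H₁ → (H₀ →L[ℝ] H₀)} {M : ℝ≥0}
    (deriv_le : ∀ u, ‖B' u‖ ≤ M * ‖u‖ ^ 2)
    (remainder_le : ∀ u w,
      ‖ι (B (u + w)) - ι (B u) - B' u (ι w)‖ ≤ M * ‖w‖ * (‖u‖ + ‖w‖) * ‖ι w‖) :
    DerivCondition ι B B' := by
  intro R hR ε hε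
  set D : ℝ := M * (R + 1) + 1
  have D_pos : 0 < D := by positivity
  refine ⟨M * R ^ 2 + 1, by positivity, min 1 (ε / D), by positivity, fun u w hu hw => ⟨?_, ?_⟩⟩
  · calc ‖B' u‖ ≤ M * ‖u‖ ^ 2 := deriv_le u
      _ ≤ M * R ^ 2 := by gcongr
      _ ≤ M * R ^ 2 + 1 := by linarith
  · have w_le_one : ‖w‖ ≤ 1 := hw.le.trans (min_le_left _ _)
    have w_le : ‖w‖ ≤ ε / D := hw.le.trans (min_le_right _ _)
    refine (remainder_le u w).trans ?_
    gcongr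
    calc M * ‖w‖ * (‖u‖ + ‖w‖) ≤ M * ‖w‖ * (R + 1) := by gcongr
      _ ≤ D * ‖w‖ := by linarith [norm_nonneg w, show D = M * (R + 1) + 1 from rfl]
      _ ≤ D * (ε / D) := by gcongr
      _ = ε := mul_div_cancel₀ ε D_pos.ne'

theorem HSob.derivCondition_hartreeMap {d : ℕ} {s : ℝ} {W : Eucl d → ℂ} {K : ℝ≥0}
    (hs : (d : ℝ) / 2 < s) (hW : ConvBound W K) :
    DerivCondition HSob.toL2 (hartreeMap hs hW) fun u => hartreeDerivCLM hW (u.memLpInter hs) := by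
  obtain ⟨A, hA⟩ := exists_eLpNormInter_le hs
  refine .of_norm_le (M := 3 * K * A ^ 2) (fun u => ?_) fun u w => ?_
  · have enorm_le := calc
      ‖hartreeDerivCLM hW (u.memLpInter hs)‖ₑ ≤ 3 * K * (A * ‖u‖ₑ) ^ 2 :=
        (enorm_hartreeDerivCLM_le hW _).trans (by gcongr; exact hA u)
      _ = (3 * K * A ^ 2 : ℝ≥0) * ‖u‖ₑ ^ 2 := by push_cast; ring
    simp only [enorm_eq_nnnorm] at enorm_le
    exact_mod_cast enorm_le
  · have enorm_le := calc
      _ ≤ _ := enorm_hartreeMap_add_sub_sub_le hs hW u w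
      _ ≤ K * (A * ‖w‖ₑ) * (3 * (A * ‖u‖ₑ) + 3 * (A * ‖w‖ₑ)) * ‖toL2 w‖ₑ := by
        gcongr
        · exact hA w
        · exact hA u
        · exact (hA w).trans (le_mul_of_one_le_left' (by norm_num))
      _ = (3 * K * A ^ 2 : ℝ≥0) * ‖w‖ₑ * (‖u‖ₑ + ‖w‖ₑ) * ‖toL2 w‖ₑ := by push_cast; ring
    simp only [enorm_eq_nnnorm] at enorm_le
    exact_mod_cast enorm_le

theorem mainTheorem8_general (d : ℕ) (s : ℝ) (hs : (d : ℝ) / 2 < s)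
    (p : ℝ≥0∞) (hp : 2 ≤ p) (W : Eucl d → ℂ) (hW : MemLpAdd W ∞ p) :
    (∀ u : HSob d s, ConvExists W (absSq (HSob.toL2 u))) ∧
    (∀ (u : HSob d s) (v : L2 d), ConvExists W (reConjMul (HSob.toL2 u) v)) ∧
    ∃ (B : HSob d s → HSob d s) (B' : HSob d s → (L2 d →L[ℝ] L2 d)),
      (∀ u : HSob d s,
        (HSob.toL2 (B u) : Eucl d → ℂ) =ᵐ[volume] hartree W (HSob.toL2 u)) ∧
      (∀ (u : HSob d s) (v : L2 d),
        (B' u v : Eucl d → ℂ) =ᵐ[volume] hartreeDeriv W (HSob.toL2 u) v) ∧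
      DerivCondition HSob.toL2 B B' := by
  obtain ⟨K, hK⟩ := (hW.top_two hp).exists_convBound
  exact ⟨fun u => hK.convExists (u.memLpInter hs).absSq,
    fun u v => hK.convExists ((u.memLpInter hs).reConjMul (Lp.memLp v)),
    HSob.hartreeMap hs hK, fun u => hartreeDerivCLM hK (u.memLpInter hs),
    HSob.coeFn_hartreeMap hs hK, fun u v => coeFn_hartreeDerivCLM hK (u.memLpInter hs) v,
    HSob.derivCondition_hartreeMap hs hK⟩

theorem mainTheorem8 (d : ℕ) (s : ℝ) (hs : (d : ℝ) / 2 < s)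
    (p : ℝ≥0∞) (hp : 2 ≤ p) (hpd : (d : ℝ≥0∞) / 4 < p)
    (W : Eucl d → ℂ) (hW : MemLpAdd W ∞ p) :
    (∀ u : HSob d s, ConvExists W (absSq (HSob.toL2 u))) ∧
    (∀ (u : HSob d s) (v : L2 d), ConvExists W (reConjMul (HSob.toL2 u) v)) ∧
    ∃ (B : HSob d s → HSob d s) (B' : HSob d s → (L2 d →L[ℝ] L2 d)),
      (∀ u : HSob d s,
        (HSob.toL2 (B u) : Eucl d → ℂ) =ᵐ[volume] hartree W (HSob.toL2 u)) ∧
      (∀ (u : HSob d s) (v : L2 d),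
        (B' u v : Eucl d → ℂ) =ᵐ[volume] hartreeDeriv W (HSob.toL2 u) v) ∧
      DerivCondition HSob.toL2 B B' :=
  mainTheorem8_general d s hs p hp W hW
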